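/- Let $(X,Y)$ be a random pair with $X\in[0,1]^d$ almost surely and $Y\in\mathbb R$ square integrable, let $(X_1,Y_1),(X_2,Y_2),\dots$ be i.i.d. copies of $(X,Y)$, and put $\mathscr D_n=((X_1,Y_1),\dots,(X_n,Y_n))$. Let $K_n$ be positive integers, $\gamma_1=\gamma_1(n)>0$ and $\gamma_2=\gamma_2(n)$ real numbers, and $C_1>0$ a constant. For each $n$, let $\Theta=\Theta_n$ be a random variable and let $T_n=T_n(\Theta,\mathscr D_n)$ be a finite binary tree grown from $\Theta$ and $\mathscr D_n$ by an arbitrary rule (for instance a randomized CART procedure): every node has zero or two children, each inner node carries a cut "is $x^{(j)}\ge\alpha$?" with $j\in\{1,\dots,d\}$, $\alpha\in\mathbb R$, the shape and the cut directions of the tree are measurable functions of $(\Theta,\mathscr D_n)$, and, for $n\ge2$, the tree almost surely has exactly $K_n$ leaves, hence $K_n-1$ inner nodes. Let $\mathscr F(\Theta,\mathscr D_n)$ be the class of all functions $$f(x)=W_{\rm out}^{\top}\,\sigma_2\big(W_2^{\top}\sigma_1(W_1^{\top}x+b_1)+b_2\big)+b_{\rm out},\qquad \sigma_i(u)=\tanh(\gamma_i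 u)\ \text{ (applied coordinatewise)},$$ where the first hidden layer has one neuron per inner node of $T_n$ and the second one has one neuron per leaf; where $W_1\in\mathbb R^{d\times(K_n-1)}$ may have a nonzero entry $(j,k)$ only if the inner node $k$ is cut along coordinate $j$; where $W_2\in\mathbb R^{(K_n-1)\times K_n}$ may have a nonzero entry $(k,k')$ only if the inner node $k$ lies on the path from the root to the leaf $k'$; where $b_1\in\mathbb R^{K_n-1}$, $b_2,W_{\rm out}\in\mathbb R^{K_n}$, $b_{\rm out}\in\mathbb R$; and where $$\|W_2\|_\infty+\|b_2\|_\infty+\|W_{\rm out}\|_1+|b_{\rm out}|\le C_1K_n ,$$ $\|\cdot\|_\infty$ being the largest absolute value of an entry and $\|\cdot\|_1$ the sum of the absolute values of the entries. Assume that $K_n\to\infty$ and $\gamma_2\to\infty$ in such a way that $K_n^6\log(\gamma_2K_n^5)/n\to0$ as $n\to\infty$. Then $$\mathbb E\sup_{f\in\mathscr F(\Theta,\mathscr D_n)}\left|\frac1n\sum_{i=1}^n|Y_i-f(X_i)|^2-\mathbb E|Y-f(X)|^2\right|\longrightarrow0\qquad(n\to\infty),$$ where, for each function $f$, $\mathbb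 E|Y-f(X)|^2$ is the risk of $f$ under the law of $(X,Y)$. -/

import Mathlib

open MeasureTheory ProbabilityTheory Filter Topology

/-- Finite ordinary binary trees (every node has zero or two children) whose inner nodes carry a
label in `β`. A regression tree on `[0,1]^d` is a `SplitTree (Fin d × ℝ)`: the label `(j, α)` of an
inner node is its cut, "is `x j ≥ α`?" (no: left child, yes: right child). -/
inductive SplitTree (β : Type) : Type where
  | leaf : SplitTree β
  | node (b : β) (l r : SplitTree β) : SplitTree β

namespace SplitTree

/-- Relabelling of the inner nodes. For a regression tree `t`, `t.map Prod.fst` keeps the shape of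
the tree and the split directions, and forgets the positions of the cuts. -/
def map {β β' : Type} (g : β → β') : SplitTree β → SplitTree β'
  | leaf => leaf
  | node b l r => node (g b) (l.map g) (r.map g)

/-- The inner nodes of a tree (`none` is the root). -/
def Inner {β : Type} : SplitTree β → Type
  | leaf => Empty
  | node _ l r => Option (l.Inner ⊕ r.Inner)

/-- The terminal nodes (leaves) of a tree. -/
def Leaf {β : Type} : SplitTree β → Type
  | leaf => Unit
  | node _ l r => l.Leaf ⊕ r.Leaf

instance instFintypeInner {β : Type} : (t : SplitTree β) → Fintype t.Inner
  | leaf => inferInstanceAs (Fintype Empty)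
  | node _ l r =>
    letI := instFintypeInner l
    letI := instFintypeInner r
    inferInstanceAs (Fintype (Option (l.Inner ⊕ r.Inner)))

instance instFintypeLeaf {β : Type} : (t : SplitTree β) → Fintype t.Leaf
  | leaf => inferInstanceAs (Fintype Unit)
  | node _ l r =>
    letI := instFintypeLeaf l
    letI := instFintypeLeaf r
    inferInstanceAs (Fintype (l.Leaf ⊕ r.Leaf))

/-- The number of terminal nodes of a tree. -/
def numLeaves {β : Type} (t : SplitTree β) : ℕ := Fintype.card t.Leaf

/-- A tree with `K` leaves has `K - 1` inner nodes. -/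
theorem card_inner_add_one {β : Type} : (t : SplitTree β) →
    Fintype.card t.Inner + 1 = t.numLeaves
  | leaf => rfl
  | node b l r => by
    have hl := card_inner_add_one l
    have hr := card_inner_add_one r
    have h1 : Fintype.card (node b l r).Inner
        = Fintype.card l.Inner + Fintype.card r.Inner + 1 :=
      Fintype.card_option.trans (congrArg (· + 1) Fintype.card_sum)
    have h2 : (node b l r).numLeaves = l.numLeaves + r.numLeaves := Fintype.card_sum
    omega

/-- The label of an inner node. -/
def label {β : Type} : (t : SplitTree β) → t.Inner → β
  | node b _ _, none => b
  | node _ l _, some (Sum.inl k) => l.label k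
  | node _ _ r, some (Sum.inr k) => r.label k

/-- `t.OnPath k k'`: the inner node `k` lies on the path from the root of `t` to the leaf `k'`. -/
def OnPath {β : Type} : (t : SplitTree β) → t.Inner → t.Leaf → Prop
  | node _ _ _, none, _ => True
  | node _ l _, some (Sum.inl k), Sum.inl k' => l.OnPath k k'
  | node _ _ r, some (Sum.inr k), Sum.inr k' => r.OnPath k k'
  | node _ _ _, some (Sum.inl _), Sum.inr _ => False
  | node _ _ _, some (Sum.inr _), Sum.inl _ => False

/-- The bipartite graph between the `d` inputs and the neurons of the first hidden layer (one per
inner node): the neuron of an inner node is connected to the coordinate along which the node is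
cut, and to no other one. -/
def graph₁ {d : ℕ} (t : SplitTree (Fin d × ℝ)) (j : Fin d) (k : t.Inner) : Prop :=
  (t.label k).1 = j

/-- The bipartite graph between the first hidden layer (one neuron per inner node) and the second
one (one neuron per leaf): `k` is connected to `k'` if and only if the split at `k` is one of those
that lead from the root to the leaf `k'`. -/
def graph₂ {d : ℕ} (t : SplitTree (Fin d × ℝ)) (k : t.Inner) (k' : t.Leaf) : Prop :=
  t.OnPath k k'

end SplitTree

/-- Weights and offsets of a network with `d` inputs, a first hidden layer with one neuron per inner
node of `t`, a second hidden layer with one neuron per leaf of `t`, and one output. -/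
structure NetParams {d : ℕ} (t : SplitTree (Fin d × ℝ)) where
  W₁ : Matrix (Fin d) t.Inner ℝ
  b₁ : t.Inner → ℝ
  W₂ : Matrix t.Inner t.Leaf ℝ
  b₂ : t.Leaf → ℝ
  Wout : t.Leaf → ℝ
  bout : ℝ

/-- The parameters whose weights vanish off the edges of the two bipartite graphs of `t` and that
satisfy `‖W₂‖_∞ + ‖b₂‖_∞ + ‖Wout‖₁ + |bout| ≤ C K`, where `K` is the number of leaves of `t`.
The first two norms are the largest absolute value of an entry (the norm of a `Pi` type). -/
def admissibleParams {d : ℕ} (C : ℝ) (t : SplitTree (Fin d × ℝ)) : Set (NetParams t) :=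
  {p | (∀ j k, ¬ t.graph₁ j k → p.W₁ j k = 0) ∧
    (∀ k k', ¬ t.graph₂ k k' → p.W₂ k k' = 0) ∧
    ‖fun (k : t.Inner) (k' : t.Leaf) => p.W₂ k k'‖ + ‖p.b₂‖ + ∑ k', |p.Wout k'| + |p.bout|
      ≤ C * (t.numLeaves : ℝ)}

/-- The function `x ↦ Woutᵀ σ₂(W₂ᵀ σ₁(W₁ᵀ x + b₁) + b₂) + bout` of a network, with the activations
`σ₁ u = tanh (γ₁ u)` and `σ₂ u = tanh (γ₂ u)` applied to each coordinate. -/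
noncomputable def NetParams.eval {d : ℕ} {t : SplitTree (Fin d × ℝ)} (γ₁ γ₂ : ℝ)
    (p : NetParams t) (x : Fin d → ℝ) : ℝ :=
  let u : t.Inner → ℝ := fun k => Real.tanh (γ₁ * (p.W₁.transpose.mulVec x + p.b₁) k)
  let v : t.Leaf → ℝ := fun k' => Real.tanh (γ₂ * (p.W₂.transpose.mulVec u + p.b₂) k')
  p.Wout ⬝ᵥ v + p.bout

/-- The class of functions implemented by the networks with the architecture of the tree `t`, under
the weight constraint with constant `C`. -/
def networkClass {d : ℕ} (γ₁ γ₂ C : ℝ) (t : SplitTree (Fin d × ℝ)) : Set ((Fin d → ℝ) → ℝ) :=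
  {f | ∃ p ∈ admissibleParams C t, f = p.eval γ₁ γ₂}

/-- The empirical squared risk `(1/n) ∑ |Yᵢ - f(Xᵢ)|²` of `f` over the sample `(Xᵢ, Yᵢ)`. -/
noncomputable def empiricalRisk {d n : ℕ} (D : Fin n → (Fin d → ℝ) × ℝ)
    (f : (Fin d → ℝ) → ℝ) : ℝ :=
  (1 / (n : ℝ)) * ∑ i, |(D i).2 - f (D i).1| ^ 2

/-- The squared risk `𝔼 |Y - f(X)|²` of a (deterministic) function `f`. -/
noncomputable def trueRisk {d : ℕ} {Ω : Type*} [MeasurableSpace Ω] (μ : Measure Ω)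
    (X : Ω → Fin d → ℝ) (Y : Ω → ℝ) (f : (Fin d → ℝ) → ℝ) : ℝ :=
  ∫ ω, |Y ω - f (X ω)| ^ 2 ∂μ

/-! The randomness of the tree is removed at once: whatever tree with `K` leaves is grown, its
networks lie in one deterministic class, with `K - 1` first-layer neurons reading one coordinate
each and `K` second-layer neurons (`networkClass_subset_axisNet`). It remains to prove a uniform law
of large numbers for this class, with weight bound `B = C₁ K`.

The loss is split as `Y² + (f(X)² - 2 Y f(X))`. The first term does not depend on `f` and obeys the
`L¹` law of large numbers. The second has a square bounded by `8 B² Y² + 2 B⁴`, which is integrable,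
so no truncation of `Y` is needed. Its supremum is handled by symmetrization and Massart's finite
class inequality, applied conditionally on the sample (`lintegral_iSup_deviation_le`).

The cover must cope with unbounded first-layer weights. On `n` points, `tanh (w x + b)` is, up to
`η`, determined by the two sets where it saturates, which are traces of half-lines, and by rounded
values at the extreme points of the middle zone (`exists_affineCode`). The other parameters are
bounded and are rounded on a grid.

With `G = γ₂ K⁵` and `η = 1 / G`, the log-cardinality is of order `K² log G + K log n`, while the
loss is of size `K²`. The estimation error is thus of order `√(K⁴ (K² log G + K log n) / n)`, which
tends to zero by the rate assumption, and the discretization error is of order `1 / K`. -/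

/-! ### Rademacher sums and finite classes. -/

/-- The sign `1` or `-1` of a Boolean. -/
def boolSign (b : Bool) : ℝ := if b then 1 else -1

theorem abs_boolSign (b : Bool) : |boolSign b| = 1 := by
  cases b <;> simp [boolSign]

/-- The signs are independent, so the exponential moment factors into a product of `cosh (l a i)`,
each at most `exp ((l a i)² / 2)`. Using `cosh` treats both tails at once. -/
theorem sum_cosh_sign_sum_le {n : ℕ} (a : Fin n → ℝ) (l V : ℝ) (hV : ∑ i, a i ^ 2 ≤ V) :
    ∑ ε : Fin n → Bool, Real.cosh (l * ∑ i, boolSign (ε i) * a i)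
      ≤ 2 ^ n * Real.exp (l ^ 2 * V / 2) := by
  have key : ∀ b : Fin n → ℝ, ∑ ε : Fin n → Bool, Real.exp (∑ i, boolSign (ε i) * b i)
      = 2 ^ n * ∏ i, Real.cosh (b i) := by
    intro b
    have h2 : (2 : ℝ) ^ n = ∏ _i : Fin n, (2 : ℝ) := by simp
    rw [h2, ← Finset.prod_mul_distrib]
    have h1 : ∀ i, 2 * Real.cosh (b i) = ∑ s : Bool, Real.exp (boolSign s * b i) := by
      intro i
      simp [boolSign, Real.cosh_eq]
      ring
    simp_rw [h1, Fintype.prod_sum, Real.exp_sum]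
  have hcosh : ∀ ε : Fin n → Bool, Real.cosh (l * ∑ i, boolSign (ε i) * a i)
      = (Real.exp (∑ i, boolSign (ε i) * (l * a i))
        + Real.exp (∑ i, boolSign (ε i) * (-(l * a i)))) / 2 := by
    intro ε
    rw [Real.cosh_eq, Finset.mul_sum, ← Finset.sum_neg_distrib]
    congr 3
    · exact Finset.sum_congr rfl fun i _ => by ring
    · exact Finset.sum_congr rfl fun i _ => by ring
  simp_rw [hcosh]
  rw [← Finset.sum_div, Finset.sum_add_distrib, key, key]
  simp only [Real.cosh_neg]
  have hprod : ∏ i, Real.cosh (l * a i) ≤ Real.exp (l ^ 2 * V / 2) := by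
    calc ∏ i, Real.cosh (l * a i) ≤ ∏ i, Real.exp ((l * a i) ^ 2 / 2) :=
          Finset.prod_le_prod (fun i _ => (Real.cosh_pos _).le)
            fun i _ => Real.cosh_le_exp_half_sq _
      _ = Real.exp (∑ i, (l * a i) ^ 2 / 2) := (Real.exp_sum _ _).symm
      _ ≤ Real.exp (l ^ 2 * V / 2) := by
          apply Real.exp_le_exp.2
          have : ∑ i, (l * a i) ^ 2 / 2 = l ^ 2 / 2 * ∑ i, a i ^ 2 := by
            rw [Finset.mul_sum]
            exact Finset.sum_congr rfl fun i _ => by ring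
          rw [this]
          nlinarith [sq_nonneg l]
  have h2 : (0 : ℝ) < 2 ^ n := by positivity
  nlinarith

/-- A version of Massart's finite class inequality: if the vectors `h s` fall into finitely many
groups and the vectors of the same group are close to each other, then the largest Rademacher sum
is small on average. -/
theorem sum_iSup_sign_sum_le {n : ℕ} {S ι : Type*} [Fintype ι] (h : S → Fin n → ℝ) (code : S → ι)
    (e : Fin n → ℝ) (hcode : ∀ s s', code s = code s' → ∀ i, |h s i - h s' i| ≤ e i)
    (V : ℝ) (hV : ∀ s, ∑ i, h s i ^ 2 ≤ V) (N : ℝ) (hN1 : 1 ≤ N) (hN : (Fintype.card ι : ℝ) ≤ N)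
    (l : ℝ) (hl : 0 < l) :
    ∑ ε : Fin n → Bool, ⨆ s, ENNReal.ofReal |∑ i, boolSign (ε i) * h s i|
      ≤ 2 ^ n * ENNReal.ofReal (Real.log (2 * N) / l + l / 2 * V + ∑ i, e i) := by
  classical
  rcases isEmpty_or_nonempty S with hS | hS
  · simp
  set r : ι → S := Function.invFun code with hr
  have hrc : ∀ s, code (r (code s)) = code s := fun s => Function.invFun_eq ⟨s, rfl⟩
  set c₀ : ℝ := 2 * N * Real.exp (l ^ 2 * V / 2) with hc₀
  have hc₀pos : 0 < c₀ := by positivity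
  -- The logarithm is replaced by its tangent at `c₀`, `log t ≤ t / c₀ + log c₀ - 1`. The bound is
  -- then linear in the `cosh` terms and can be averaged without Jensen's inequality; as `c₀` bounds
  -- the mean of their sum, the quotient averages to at most `1` and cancels the `-1`.
  set B : (Fin n → Bool) → ℝ := fun ε =>
    ((∑ c, 2 * Real.cosh (l * ∑ i, boolSign (ε i) * h (r c) i)) / c₀ + Real.log c₀ - 1) / l
      + ∑ i, e i with hB
  have hle : ∀ ε s, |∑ i, boolSign (ε i) * h s i| ≤ B ε := by
    intro ε s
    set c := code s
    have h1 : |∑ i, boolSign (ε i) * h s i|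
        ≤ |∑ i, boolSign (ε i) * h (r c) i| + ∑ i, e i := by
      have : ∑ i, boolSign (ε i) * h s i = ∑ i, boolSign (ε i) * h (r c) i
          + ∑ i, boolSign (ε i) * (h s i - h (r c) i) := by
        rw [← Finset.sum_add_distrib]
        exact Finset.sum_congr rfl fun i _ => by ring
      rw [this]
      refine (abs_add_le _ _).trans ?_
      gcongr
      refine (Finset.abs_sum_le_sum_abs _ _).trans (Finset.sum_le_sum fun i _ => ?_)
      rw [abs_mul, abs_boolSign, one_mul]
      exact hcode _ _ (hrc s).symm i
    refine h1.trans ?_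
    simp only [hB]
    gcongr
    rw [le_div_iff₀ hl]
    set u := ∑ i, boolSign (ε i) * h (r c) i
    have h2 : Real.exp (|u| * l) ≤ ∑ c, 2 * Real.cosh (l * ∑ i, boolSign (ε i) * h (r c) i) := by
      calc Real.exp (|u| * l) ≤ 2 * Real.cosh (l * u) := by
            rw [← Real.cosh_abs, abs_mul, abs_of_pos hl, mul_comm, Real.cosh_eq]
            have := Real.exp_pos (-(l * |u|))
            linarith
        _ ≤ _ := Finset.single_le_sum
            (f := fun c => 2 * Real.cosh (l * ∑ i, boolSign (ε i) * h (r c) i))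
            (fun c _ => by have := Real.cosh_pos (l * ∑ i, boolSign (ε i) * h (r c) i); positivity)
            (Finset.mem_univ c)
    have h3 := Real.add_one_le_exp (|u| * l - Real.log c₀)
    rw [Real.exp_sub, Real.exp_log hc₀pos] at h3
    have h4 := div_le_div_of_nonneg_right h2 hc₀pos.le
    linarith
  have hB0 : ∀ ε, 0 ≤ B ε := fun ε => (abs_nonneg _).trans (hle ε hS.some)
  have hsum : ∑ ε, B ε ≤ 2 ^ n * (Real.log (2 * N) / l + l / 2 * V + ∑ i, e i) := by
    have hcard : ∑ _ε : Fin n → Bool, (1 : ℝ) = 2 ^ n := by simp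
    have h5 : ∑ ε : Fin n → Bool, ∑ c, 2 * Real.cosh (l * ∑ i, boolSign (ε i) * h (r c) i)
        ≤ 2 ^ n * c₀ := by
      rw [Finset.sum_comm]
      calc _ ≤ ∑ _c : ι, 2 * (2 ^ n * Real.exp (l ^ 2 * V / 2)) := by
            refine Finset.sum_le_sum fun c _ => ?_
            rw [← Finset.mul_sum]
            gcongr
            exact sum_cosh_sign_sum_le _ _ _ (hV _)
        _ = Fintype.card ι * (2 * (2 ^ n * Real.exp (l ^ 2 * V / 2))) := by simp
        _ ≤ N * (2 * (2 ^ n * Real.exp (l ^ 2 * V / 2))) := by gcongr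
        _ = 2 ^ n * c₀ := by rw [hc₀]; ring
    have h6 : ∑ ε, B ε = ((∑ ε : Fin n → Bool,
        ∑ c, 2 * Real.cosh (l * ∑ i, boolSign (ε i) * h (r c) i)) / c₀
        + 2 ^ n * (Real.log c₀ - 1)) / l + 2 ^ n * ∑ i, e i := by
      simp only [hB]
      rw [Finset.sum_add_distrib, ← Finset.sum_div]
      congr 1
      · congr 1
        simp_rw [add_sub_assoc]
        rw [Finset.sum_add_distrib, ← Finset.sum_div, Finset.sum_const, ← hcard]
        simp
      · simp
    rw [h6]
    have h7 : Real.log c₀ = Real.log (2 * N) + l ^ 2 * V / 2 := by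
      rw [hc₀, Real.log_mul (by positivity) (Real.exp_pos _).ne', Real.log_exp]
    have h8 := (div_le_iff₀ hc₀pos).2 h5
    rw [h7]
    have h9 : (2 : ℝ) ^ n * (Real.log (2 * N) / l + l / 2 * V + ∑ i, e i)
        = (2 ^ n + 2 ^ n * (Real.log (2 * N) + l ^ 2 * V / 2 - 1)) / l + 2 ^ n * ∑ i, e i := by
      field_simp
      ring
    rw [h9]
    gcongr
  calc _ ≤ ∑ ε, ENNReal.ofReal (B ε) :=
        Finset.sum_le_sum fun ε _ => iSup_le fun s => ENNReal.ofReal_le_ofReal (hle ε s)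
    _ = ENNReal.ofReal (∑ ε, B ε) := (ENNReal.ofReal_sum_of_nonneg fun ε _ => hB0 ε).symm
    _ ≤ ENNReal.ofReal (2 ^ n * (Real.log (2 * N) / l + l / 2 * V + ∑ i, e i)) :=
        ENNReal.ofReal_le_ofReal hsum
    _ = _ := by
        rw [ENNReal.ofReal_mul (by positivity), ENNReal.ofReal_pow (by positivity)]
        simp

/-! ### Symmetrization and the maximal inequality. -/

section Symmetrization

variable {E : Type*} [MeasurableSpace E] {n : ℕ}

/-- Exchange of two samples at the indices where the sign is `false`. -/
def swapSample (ε : Fin n → Bool) (p : (Fin n → E) × (Fin n → E)) : (Fin n → E) × (Fin n → E) :=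
  (fun i => if ε i then p.1 i else p.2 i, fun i => if ε i then p.2 i else p.1 i)

theorem measurePreserving_swapSample (ν : Measure E) [IsProbabilityMeasure ν] (ε : Fin n → Bool) :
    MeasurePreserving (swapSample ε)
      ((Measure.pi fun _ : Fin n => ν).prod (Measure.pi fun _ : Fin n => ν))
      ((Measure.pi fun _ : Fin n => ν).prod (Measure.pi fun _ : Fin n => ν)) := by
  have h1 := measurePreserving_arrowProdEquivProdArrow E E (Fin n) (fun _ => ν) (fun _ => ν)
  have h2 : MeasurePreserving (fun (a : Fin n → E × E) i => if ε i then a i else (a i).swap)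
      (Measure.pi fun _ => ν.prod ν) (Measure.pi fun _ => ν.prod ν) := by
    refine measurePreserving_pi (fun _ => ν.prod ν) (fun _ => ν.prod ν)
      (f := fun i a => if ε i then a else a.swap) fun i => ?_
    cases ε i
    · simpa using Measure.measurePreserving_swap
    · simp only [if_true]
      exact MeasurePreserving.id _
  -- Seen as one sample of pairs, the exchange acts coordinatewise, by the identity or by
  -- `Prod.swap`.
  have h3 := h1.comp (h2.comp (h1.symm _))
  convert h3 using 1
  funext p
  ext i
  · change _ = (if ε i then (p.1 i, p.2 i) else (p.1 i, p.2 i).swap).1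
    cases h : ε i <;> simp [swapSample, h]
  · change _ = (if ε i then (p.1 i, p.2 i) else (p.1 i, p.2 i).swap).2
    cases h : ε i <;> simp [swapSample, h]

/-- Exchanging the two samples where the sign is negative preserves their joint law and puts the
signs in front of the differences; the triangle inequality then separates the samples. Countability
of `S` makes the suprema measurable. -/
theorem lintegral_iSup_sub_eq_sign {S : Type*} [Countable S] (ν : Measure E)
    [IsProbabilityMeasure ν] (h : S → E → ℝ) (hm : ∀ s, Measurable (h s)) (ε : Fin n → Bool) :
    ∫⁻ z, ∫⁻ z', ⨆ s, ENNReal.ofReal |∑ i, (h s (z i) - h s (z' i))|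
        ∂(Measure.pi fun _ : Fin n => ν) ∂(Measure.pi fun _ : Fin n => ν)
      ≤ 2 * ∫⁻ z, ⨆ s, ENNReal.ofReal |∑ i, boolSign (ε i) * h s (z i)|
        ∂(Measure.pi fun _ : Fin n => ν) := by
  set P := Measure.pi fun _ : Fin n => ν
  have hmeas : Measurable fun z : Fin n → E =>
      ⨆ s, ENNReal.ofReal |∑ i, boolSign (ε i) * h s (z i)| := by
    refine Measurable.iSup fun s => ?_
    have := hm s
    fun_prop
  have hmeas2 : Measurable fun p : (Fin n → E) × (Fin n → E) =>
      ⨆ s, ENNReal.ofReal |∑ i, (h s (p.1 i) - h s (p.2 i))| := by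
    refine Measurable.iSup fun s => ?_
    have := hm s
    fun_prop
  rw [lintegral_lintegral hmeas2.aemeasurable,
    ← (measurePreserving_swapSample ν ε).lintegral_comp hmeas2]
  calc _ ≤ ∫⁻ p : (Fin n → E) × (Fin n → E),
          (⨆ s, ENNReal.ofReal |∑ i, boolSign (ε i) * h s (p.1 i)|)
          + (⨆ s, ENNReal.ofReal |∑ i, boolSign (ε i) * h s (p.2 i)|) ∂(P.prod P) := by
        refine lintegral_mono fun p => iSup_le fun s => ?_
        refine le_trans ?_ (add_le_add
          (le_iSup (fun s => ENNReal.ofReal |∑ i, boolSign (ε i) * h s (p.1 i)|) s)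
          (le_iSup (fun s => ENNReal.ofReal |∑ i, boolSign (ε i) * h s (p.2 i)|) s))
        rw [← ENNReal.ofReal_add (abs_nonneg _) (abs_nonneg _)]
        refine ENNReal.ofReal_le_ofReal ?_
        have : ∑ i, (h s ((swapSample ε p).1 i) - h s ((swapSample ε p).2 i))
            = ∑ i, boolSign (ε i) * h s (p.1 i) - ∑ i, boolSign (ε i) * h s (p.2 i) := by
          rw [← Finset.sum_sub_distrib]
          refine Finset.sum_congr rfl fun i _ => ?_
          simp only [swapSample, boolSign]
          cases ε i <;> simp
          ring
        rw [this]
        exact abs_sub _ _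
    _ = 2 * ∫⁻ z, ⨆ s, ENNReal.ofReal |∑ i, boolSign (ε i) * h s (z i)| ∂P := by
        have hmeas1 : Measurable fun p : (Fin n → E) × (Fin n → E) =>
            ⨆ s, ENNReal.ofReal |∑ i, boolSign (ε i) * h s (p.1 i)| := hmeas.comp measurable_fst
        rw [lintegral_add_left hmeas1, two_mul]
        congr 1
        · exact measurePreserving_fst.lintegral_comp hmeas
        · exact measurePreserving_snd.lintegral_comp hmeas

/-- Symmetrization by a ghost sample. -/
theorem lintegral_iSup_deviation_le_sub {S : Type*} [Countable S] (ν : Measure E)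
    [IsProbabilityMeasure ν] (h : S → E → ℝ) (hi : ∀ s, Integrable (h s) ν) :
    ∫⁻ z, ⨆ s, ENNReal.ofReal |∑ i, h s (z i) - n * ∫ x, h s x ∂ν|
        ∂(Measure.pi fun _ : Fin n => ν)
      ≤ ∫⁻ z, ∫⁻ z', ⨆ s, ENNReal.ofReal |∑ i, (h s (z i) - h s (z' i))|
        ∂(Measure.pi fun _ : Fin n => ν) ∂(Measure.pi fun _ : Fin n => ν) := by
  set P := Measure.pi fun _ : Fin n => ν
  refine lintegral_mono fun z => iSup_le fun s => ?_
  have hint : ∀ i, Integrable (fun z' : Fin n → E => h s (z' i)) P := fun i =>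
    (measurePreserving_eval (fun _ : Fin n => ν) i).integrable_comp_of_integrable (hi s)
  have heq : ∑ i, h s (z i) - n * ∫ x, h s x ∂ν = ∫ z', ∑ i, (h s (z i) - h s (z' i)) ∂P := by
    have hsub : ∀ i, Integrable (fun z' : Fin n → E => h s (z i) - h s (z' i)) P := fun i =>
      (integrable_const _).sub (hint i)
    rw [integral_finsetSum _ fun i _ => hsub i]
    simp_rw [integral_sub (integrable_const _) (hint _)]
    rw [Finset.sum_sub_distrib]
    have : ∀ i, ∫ z', h s (z' i) ∂P = ∫ x, h s x ∂ν := fun i =>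
      integral_comp_eval (μ := fun _ : Fin n => ν) (hi s).aestronglyMeasurable
    simp [this]
  rw [heq, ← Real.enorm_eq_ofReal_abs]
  refine (enorm_integral_le_lintegral_enorm _).trans (lintegral_mono fun z' => ?_)
  rw [Real.enorm_eq_ofReal_abs]
  exact le_iSup (fun s => ENNReal.ofReal |∑ i, (h s (z i) - h s (z' i))|) s

/-- A maximal inequality for the empirical process indexed by a countable family of functions that
has, on every sample, a finite cover of bounded cardinality. -/
theorem lintegral_iSup_deviation_le {S : Type*} [Countable S] (ν : Measure E)
    [IsProbabilityMeasure ν] (h : S → E → ℝ) (hm : ∀ s, Measurable (h s))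
    (v e : E → ℝ) (hv : ∀ s x, h s x ^ 2 ≤ v x) (hvi : Integrable v ν) (hei : Integrable e ν)
    (hen : ∀ x, 0 ≤ e x)
    (N : ℝ) (hN1 : 1 ≤ N)
    (hcover : ∀ z : Fin n → E, ∃ (k : ℕ) (code : S → Fin k), (k : ℝ) ≤ N ∧
      ∀ s s', code s = code s' → ∀ i, |h s (z i) - h s' (z i)| ≤ e (z i))
    (l : ℝ) (hl : 0 < l) :
    ∫⁻ z, ⨆ s, ENNReal.ofReal |∑ i, h s (z i) - n * ∫ x, h s x ∂ν|
        ∂(Measure.pi fun _ : Fin n => ν)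
      ≤ 2 * ENNReal.ofReal
        (Real.log (2 * N) / l + l / 2 * (n * ∫ x, v x ∂ν) + n * ∫ x, e x ∂ν) := by
  rcases isEmpty_or_nonempty S with hS | ⟨⟨s₀⟩⟩
  · simp
  set P := Measure.pi fun _ : Fin n => ν
  have hvn : ∀ x, 0 ≤ v x := fun x => (sq_nonneg _).trans (hv s₀ x)
  have hi : ∀ s, Integrable (h s) ν := by
    intro s
    have : MemLp (h s) 2 ν := by
      rw [memLp_two_iff_integrable_sq (hm s).aestronglyMeasurable]
      exact hvi.mono' ((hm s).pow_const 2).aestronglyMeasurable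
        (ae_of_all _ fun x => by simpa using hv s x)
    exact this.integrable one_le_two
  have hint : ∀ {g : E → ℝ}, Integrable g ν → ∀ i, Integrable (fun z : Fin n → E => g (z i)) P :=
    fun hg i => (measurePreserving_eval (fun _ : Fin n => ν) i).integrable_comp_of_integrable hg
  have hval : ∀ {g : E → ℝ}, Integrable g ν → ∫ z, ∑ i, g (z i) ∂P = n * ∫ x, g x ∂ν := by
    intro g hg
    rw [integral_finsetSum _ fun i _ => hint hg i]
    have : ∀ i, ∫ z', g (z' i) ∂P = ∫ x, g x ∂ν := fun i =>
      integral_comp_eval (μ := fun _ : Fin n => ν) hg.aestronglyMeasurable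
    simp [this]
  set R : (Fin n → E) → ℝ := fun z =>
    Real.log (2 * N) / l + l / 2 * ∑ i, v (z i) + ∑ i, e (z i) with hR
  have hlog : 0 ≤ Real.log (2 * N) := Real.log_nonneg (by linarith)
  have hRn : ∀ z, 0 ≤ R z := by
    intro z
    have h1 : 0 ≤ ∑ i, v (z i) := Finset.sum_nonneg fun i _ => hvn _
    have h2 : 0 ≤ ∑ i, e (z i) := Finset.sum_nonneg fun i _ => hen _
    have h3 : 0 ≤ l / 2 * ∑ i, v (z i) := by positivity
    have h4 : 0 ≤ Real.log (2 * N) / l := by positivity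
    simp only [hR]
    linarith
  have hRi : Integrable R P := by
    refine ((integrable_const _).add ((integrable_finsetSum _ fun i _ => hint hvi i).const_mul _)).add
      (integrable_finsetSum _ fun i _ => hint hei i)
  have hRval : ∫ z, R z ∂P
      = Real.log (2 * N) / l + l / 2 * (n * ∫ x, v x ∂ν) + n * ∫ x, e x ∂ν := by
    have i1 : Integrable (fun z : Fin n → E => ∑ i, v (z i)) P :=
      integrable_finsetSum _ fun i _ => hint hvi i
    have i2 : Integrable (fun z : Fin n → E => ∑ i, e (z i)) P :=
      integrable_finsetSum _ fun i _ => hint hei i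
    simp only [hR]
    have i3 : Integrable (fun z : Fin n → E =>
        Real.log (2 * N) / l + l / 2 * ∑ i, v (z i)) P := (integrable_const _).add (i1.const_mul _)
    rw [integral_add i3 i2,
      integral_add (integrable_const _) (i1.const_mul _), integral_const_mul, hval hvi, hval hei]
    simp
  set A := ∫⁻ z, ∫⁻ z', ⨆ s, ENNReal.ofReal |∑ i, (h s (z i) - h s (z' i))| ∂P ∂P with hA
  refine (lintegral_iSup_deviation_le_sub ν h hi).trans ?_
  -- `A` does not depend on the signs, so it may be averaged over them; with the average inside the
  -- integral, the finite class bound applies on each fixed sample.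
  have hsum : 2 ^ n * A ≤ 2 ^ n * (2 * ENNReal.ofReal (∫ z, R z ∂P)) := by
    calc 2 ^ n * A = ∑ _ε : Fin n → Bool, A := by simp
      _ ≤ ∑ ε : Fin n → Bool,
            2 * ∫⁻ z, ⨆ s, ENNReal.ofReal |∑ i, boolSign (ε i) * h s (z i)| ∂P :=
          Finset.sum_le_sum fun ε _ => lintegral_iSup_sub_eq_sign ν h hm ε
      _ = 2 * ∫⁻ z, ∑ ε : Fin n → Bool,
            ⨆ s, ENNReal.ofReal |∑ i, boolSign (ε i) * h s (z i)| ∂P := by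
          rw [← Finset.mul_sum, lintegral_finsetSum]
          intro ε _
          refine Measurable.iSup fun s => ?_
          have := hm s
          fun_prop
      _ ≤ 2 * ∫⁻ z, 2 ^ n * ENNReal.ofReal (R z) ∂P := by
          gcongr with z
          obtain ⟨k, code, hk, hcode⟩ := hcover z
          exact sum_iSup_sign_sum_le (fun s i => h s (z i)) code (fun i => e (z i)) hcode
            (∑ i, v (z i)) (fun s => Finset.sum_le_sum fun i _ => hv s (z i)) N hN1 (by simpa) l hl
      _ = 2 ^ n * (2 * ENNReal.ofReal (∫ z, R z ∂P)) := by
          rw [lintegral_const_mul' _ _ (by simp), ← ofReal_integral_eq_lintegral_ofReal hRi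
            (ae_of_all _ hRn)]
          ring
  rw [hRval] at hsum
  exact (ENNReal.mul_le_mul_iff_right (by simp) (by simp)).1 hsum

end Symmetrization

/-! ### Covering a single neuron on a finite sample. -/

theorem hasDerivAt_real_tanh (x : ℝ) : HasDerivAt Real.tanh (1 / Real.cosh x ^ 2) x := by
  have h := (Real.hasDerivAt_sinh x).div (Real.hasDerivAt_cosh x) (Real.cosh_pos x).ne'
  have h1 : Real.tanh = Real.sinh / Real.cosh := by
    funext y
    exact Real.tanh_eq_sinh_div_cosh y
  rw [h1]
  have h2 : Real.cosh x * Real.cosh x - Real.sinh x * Real.sinh x = 1 := by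
    have := Real.cosh_sq x
    nlinarith
  rwa [h2] at h

theorem abs_tanh_sub_tanh_le (x y : ℝ) : |Real.tanh x - Real.tanh y| ≤ |x - y| := by
  have h := Convex.norm_image_sub_le_of_norm_hasDerivWithin_le (f := Real.tanh)
    (f' := fun x => 1 / Real.cosh x ^ 2) (C := 1) (s := Set.univ) (x := y) (y := x)
    (fun z _ => (hasDerivAt_real_tanh z).hasDerivWithinAt) (fun z _ => ?_) convex_univ
    (Set.mem_univ _) (Set.mem_univ _)
  · simpa using h
  · rw [Real.norm_of_nonneg (by positivity)]
    have := Real.one_le_cosh z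
    rw [div_le_one (by positivity)]
    nlinarith

theorem continuous_real_tanh : Continuous Real.tanh :=
  continuous_iff_continuousAt.2 fun x => (hasDerivAt_real_tanh x).continuousAt

/-- A saturation threshold of order `log (1 / η)` would do; `1 / η` is simpler and keeps the cover
polynomial in `1 / η`. -/
theorem one_sub_tanh_le {η x : ℝ} (hη : 0 < η) (hx : 1 / η < x) : 1 - Real.tanh x ≤ η := by
  have hx0 : 0 < x := lt_trans (by positivity) hx
  have h1 : 1 - Real.tanh x = 2 * Real.exp (-x) / (Real.exp x + Real.exp (-x)) := by
    rw [Real.tanh_eq]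
    have : Real.exp x + Real.exp (-x) ≠ 0 := by positivity
    field_simp
    ring
  rw [h1, div_le_iff₀ (by positivity)]
  have h2 : Real.exp (-x) ≤ 1 := Real.exp_le_one_iff.2 (by linarith)
  have h3 : 1 ≤ η * x := by
    rw [div_lt_iff₀ hη] at hx
    linarith
  have h4 : Real.exp x = Real.exp (-x) * Real.exp (2 * x) := by
    rw [← Real.exp_add]
    congr 1
    ring
  have h5 := Real.add_one_le_exp (2 * x)
  have h6 := Real.exp_pos (-x)
  have h7 : 2 ≤ η * Real.exp (2 * x) := by nlinarith
  rw [h4]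
  nlinarith [mul_pos hη h6]

/-- Cells of width `η` for the interval `[-B, B]`. -/
noncomputable def gridCode (B η x : ℝ) : Fin (⌊2 * B / η⌋₊ + 1) :=
  ⟨min ⌊(x + B) / η⌋₊ ⌊2 * B / η⌋₊, by omega⟩

theorem abs_sub_le_of_gridCode_eq {B η x y : ℝ} (hη : 0 < η) (hx : |x| ≤ B) (hy : |y| ≤ B)
    (h : gridCode B η x = gridCode B η y) : |x - y| ≤ η := by
  -- On `[-B, B]` the truncation in the code is inactive.
  have hfl : ∀ {u : ℝ}, |u| ≤ B → min ⌊(u + B) / η⌋₊ ⌊2 * B / η⌋₊ = ⌊(u + B) / η⌋₊ := by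
    intro u hu
    apply min_eq_left
    apply Nat.floor_mono
    gcongr
    linarith [(abs_le.1 hu).2]
  have h' := congrArg Fin.val h
  simp only [gridCode] at h'
  rw [hfl hx, hfl hy] at h'
  have hx0 : 0 ≤ (x + B) / η := div_nonneg (by linarith [(abs_le.1 hx).1]) hη.le
  have hy0 : 0 ≤ (y + B) / η := div_nonneg (by linarith [(abs_le.1 hy).1]) hη.le
  have a1 := Nat.floor_le hx0
  have a2 := Nat.lt_floor_add_one ((x + B) / η)
  have b1 := Nat.floor_le hy0
  have b2 := Nat.lt_floor_add_one ((y + B) / η)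
  rw [h'] at a1 a2
  have c1 : (x + B) / η - (y + B) / η = (x - y) / η := by ring
  have c2 : |(x - y) / η| ≤ 1 := by
    rw [← c1, abs_le]
    constructor <;> linarith
  rwa [abs_div, abs_of_pos hη, div_le_one hη] at c2

/-- The set of the sample points above (`true`) or below (`false`) a given sample point. -/
def sampleHalfLine {n : ℕ} (s : Fin n → ℝ) : Option (Fin n) × Bool → Set (Fin n)
  | (none, _) => ∅
  | (some p, true) => {i | s p ≤ s i}
  | (some p, false) => {i | s i ≤ s p}

/-- An affine function is monotone, so the part of the sample above a level is delimited by its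
smallest or largest point. Hence there are at most `2 (n + 1)` such parts, whatever the size of `w`
and `b`. -/
theorem exists_sampleHalfLine {n : ℕ} (s : Fin n → ℝ) (A w b : ℝ) :
    ∃ c, sampleHalfLine s c = {i | A < w * s i + b} := by
  classical
  set U : Finset (Fin n) := Finset.univ.filter fun i => A < w * s i + b with hU
  have hmem : ∀ i, i ∈ U ↔ A < w * s i + b := by simp [hU]
  rcases U.eq_empty_or_nonempty with h | h
  · refine ⟨(none, true), ?_⟩
    ext i
    have := hmem i
    simp only [h, Finset.notMem_empty, false_iff] at this
    simp [sampleHalfLine, not_lt.1 this]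
  · rcases le_total 0 w with hw | hw
    · obtain ⟨p, hp, hmin⟩ := U.exists_min_image s h
      refine ⟨(some p, true), ?_⟩
      ext i
      refine ⟨fun hi => ?_, fun hi => hmin i ((hmem i).2 hi)⟩
      have h1 : s p ≤ s i := hi
      have h2 := (hmem p).1 hp
      have := mul_le_mul_of_nonneg_left h1 hw
      change A < w * s i + b
      linarith
    · obtain ⟨p, hp, hmax⟩ := U.exists_max_image s h
      refine ⟨(some p, false), ?_⟩
      ext i
      refine ⟨fun hi => ?_, fun hi => hmax i ((hmem i).2 hi)⟩
      have h1 : s i ≤ s p := hi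
      have h2 := (hmem p).1 hp
      have := mul_le_mul_of_nonpos_left h1 hw
      change A < w * s i + b
      linarith

theorem exists_extreme_indices {n : ℕ} (hn : 0 < n) (s : Fin n → ℝ) (M : Fin n → Prop) :
    ∃ p : Fin n × Fin n, ∀ i, M i → M p.1 ∧ M p.2 ∧ s p.1 ≤ s i ∧ s i ≤ s p.2 := by
  classical
  rcases (Finset.univ.filter M).eq_empty_or_nonempty with h | h
  · refine ⟨(⟨0, hn⟩, ⟨0, hn⟩), fun i hi => ?_⟩
    have : i ∈ Finset.univ.filter M := by simpa using hi
    simp [h] at this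
  · obtain ⟨p, hp, hmin⟩ := (Finset.univ.filter M).exists_min_image s h
    obtain ⟨q, hq, hmax⟩ := (Finset.univ.filter M).exists_max_image s h
    exact ⟨(p, q), fun i hi => ⟨by simpa using hp, by simpa using hq, hmin i (by simpa using hi),
      hmax i (by simpa using hi)⟩⟩

/-- The codes for affine functions of one variable on a sample of size `n`. -/
abbrev AffineCode (n g : ℕ) : Type :=
  (Option (Fin n) × Bool) × (Option (Fin n) × Bool) × (Fin n × Fin n) × (Fin g × Fin g)

/-- On a sample of size `n`, the functions `x ↦ tanh (w x + b)` form a number of groups that is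
polynomial in `n` and `1 / η`, the functions of the same group being `η`-close on the sample. -/
theorem exists_affineCode {n : ℕ} (hn : 0 < n) (s : Fin n → ℝ) {η : ℝ} (hη : 0 < η) :
    ∃ code : ℝ × ℝ → AffineCode n (⌊2 * (1 / η) / η⌋₊ + 1),
      ∀ q q', code q = code q' → ∀ i,
        |Real.tanh (q.1 * s i + q.2) - Real.tanh (q'.1 * s i + q'.2)| ≤ η := by
  set A := 1 / η with hA
  choose cU hU using fun q : ℝ × ℝ => exists_sampleHalfLine s A q.1 q.2
  choose cM hM using fun q : ℝ × ℝ =>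
    exists_extreme_indices hn s fun i => |q.1 * s i + q.2| ≤ A
  -- The upper and lower saturated zones (the lower one is the upper zone of `-q`), the extreme
  -- points of the middle zone, and the rounded affine values there.
  refine ⟨fun q => (cU q, cU (-q), cM q,
    gridCode A η (q.1 * s (cM q).1 + q.2), gridCode A η (q.1 * s (cM q).2 + q.2)),
    fun q q' h i => ?_⟩
  simp only [Prod.mk.injEq] at h
  obtain ⟨h1, h2, h3, h4, h5⟩ := h
  have e1 : A < q.1 * s i + q.2 ↔ A < q'.1 * s i + q'.2 := by
    have := (hU q).symm.trans ((congrArg _ h1).trans (hU q'))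
    exact Set.ext_iff.1 this i
  have e2 : q.1 * s i + q.2 < -A ↔ q'.1 * s i + q'.2 < -A := by
    have := (hU (-q)).symm.trans ((congrArg _ h2).trans (hU (-q')))
    have := Set.ext_iff.1 this i
    simp only [Set.mem_ofPred_eq, Prod.fst_neg, Prod.snd_neg] at this
    constructor
    · intro h
      linarith [this.1 (by linarith)]
    · intro h
      linarith [this.2 (by linarith)]
  by_cases c1 : A < q.1 * s i + q.2
  · have b1 := one_sub_tanh_le hη c1
    have b2 := one_sub_tanh_le hη (e1.1 c1)
    have b3 := Real.tanh_lt_one (q.1 * s i + q.2)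
    have b4 := Real.tanh_lt_one (q'.1 * s i + q'.2)
    rw [abs_le]
    constructor <;> linarith
  by_cases c2 : q.1 * s i + q.2 < -A
  · have b1 := one_sub_tanh_le (x := -(q.1 * s i + q.2)) hη (by linarith)
    have b2 := one_sub_tanh_le (x := -(q'.1 * s i + q'.2)) hη (by linarith [e2.1 c2])
    rw [Real.tanh_neg] at b1 b2
    have b3 := Real.neg_one_lt_tanh (q.1 * s i + q.2)
    have b4 := Real.neg_one_lt_tanh (q'.1 * s i + q'.2)
    rw [abs_le]
    constructor <;> linarith
  have m1 : |q.1 * s i + q.2| ≤ A := abs_le.2 ⟨not_lt.1 c2, not_lt.1 c1⟩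
  have m2 : |q'.1 * s i + q'.2| ≤ A :=
    abs_le.2 ⟨not_lt.1 fun h => c2 (e2.2 h), not_lt.1 fun h => c1 (e1.2 h)⟩
  obtain ⟨u1, u2, u3, u4⟩ := hM q i m1
  obtain ⟨v1, v2, -, -⟩ := hM q' i m2
  rw [← h3] at h4 h5 v1 v2
  have d1 := abs_le.1 (abs_sub_le_of_gridCode_eq hη u1 v1 h4)
  have d2 := abs_le.1 (abs_sub_le_of_gridCode_eq hη u2 v2 h5)
  refine (abs_tanh_sub_tanh_le _ _).trans (abs_le.2 ?_)
  -- The difference of two affine functions is monotone, so on the middle zone it lies between its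
  -- values at the two extreme points.
  rcases le_total 0 (q.1 - q'.1) with hc | hc
  · have k1 := mul_le_mul_of_nonneg_left u3 hc
    have k2 := mul_le_mul_of_nonneg_left u4 hc
    constructor <;> nlinarith
  · have k1 := mul_le_mul_of_nonpos_left u3 hc
    have k2 := mul_le_mul_of_nonpos_left u4 hc
    constructor <;> nlinarith

/-! ### Networks with one input per first-layer neuron, and their covers. -/

/-- Parameters of a network with `d` inputs, `m` first-layer neurons that are connected to one input
each, and `K` second-layer neurons: the selected inputs, the weights and offsets of the first layer,
the weights of the second layer, its offsets, the output weights, and the output offset. -/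
abbrev AxisNetParams (d m K : ℕ) : Type :=
  (Fin m → Fin d) × (Fin m → ℝ × ℝ) × (Fin m → Fin K → ℝ) × (Fin K → ℝ) × (Fin K → ℝ) × ℝ

/-- The function of a network whose first-layer neurons are connected to one input each. -/
noncomputable def axisNetEval {d m K : ℕ} (γ : ℝ) (p : AxisNetParams d m K) (x : Fin d → ℝ) : ℝ :=
  ∑ k', p.2.2.2.2.1 k' * Real.tanh (γ * (∑ k, p.2.2.1 k k' *
    Real.tanh ((p.2.1 k).1 * x (p.1 k) + (p.2.1 k).2) + p.2.2.2.1 k')) + p.2.2.2.2.2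

/-- The parameters whose second-layer and output weights are bounded by `B`. -/
def boundedAxisNetParams (d m K : ℕ) (B : ℝ) : Set (AxisNetParams d m K) :=
  {p | (∀ k k', |p.2.2.1 k k'| ≤ B) ∧ (∀ k', |p.2.2.2.1 k'| ≤ B) ∧
    ∑ k', |p.2.2.2.2.1 k'| + |p.2.2.2.2.2| ≤ B}

theorem abs_axisNetEval_le {d m K : ℕ} {γ B : ℝ} {p : AxisNetParams d m K}
    (hp : p ∈ boundedAxisNetParams d m K B) (x : Fin d → ℝ) : |axisNetEval γ p x| ≤ B := by
  refine (abs_add_le _ _).trans (le_trans ?_ hp.2.2)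
  gcongr
  refine (Finset.abs_sum_le_sum_abs _ _).trans (Finset.sum_le_sum fun k' _ => ?_)
  rw [abs_mul]
  exact mul_le_of_le_one_right (abs_nonneg _) (Real.abs_tanh_lt_one _).le

theorem abs_mul_sub_mul_le {a a' u u' B α β : ℝ} (ha : |a| ≤ B) (hu' : |u'| ≤ 1)
    (h1 : |u - u'| ≤ α) (h2 : |a - a'| ≤ β) : |a * u - a' * u'| ≤ B * α + β := by
  have : a * u - a' * u' = a * (u - u') + (a - a') * u' := by ring
  rw [this]
  refine (abs_add_le _ _).trans ?_
  rw [abs_mul, abs_mul]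
  have hα : 0 ≤ α := (abs_nonneg _).trans h1
  have hB : 0 ≤ B := (abs_nonneg _).trans ha
  refine add_le_add (mul_le_mul ha h1 (abs_nonneg _) hB) ?_
  exact (mul_le_of_le_one_right (abs_nonneg _) hu').trans h2

/-- Errors propagate through the layers because `tanh` is 1-Lipschitz and bounded by 1. The `ℓ¹`
bound on the output weights gives a factor `B`, rather than `K * B`, in front of the second-layer
error; this is what makes `η = 1 / (γ K⁵)` fine enough. -/
theorem abs_axisNetEval_sub_le {d m K : ℕ} {γ B η : ℝ} (hγ : 0 ≤ γ) (hB : 0 ≤ B)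
    {p p' : AxisNetParams d m K} (hp : p ∈ boundedAxisNetParams d m K B) (x : Fin d → ℝ)
    (h1 : ∀ k, |Real.tanh ((p.2.1 k).1 * x (p.1 k) + (p.2.1 k).2)
      - Real.tanh ((p'.2.1 k).1 * x (p'.1 k) + (p'.2.1 k).2)| ≤ η)
    (h2 : ∀ k k', |p.2.2.1 k k' - p'.2.2.1 k k'| ≤ η)
    (h3 : ∀ k', |p.2.2.2.1 k' - p'.2.2.2.1 k'| ≤ η)
    (h4 : ∀ k', |p.2.2.2.2.1 k' - p'.2.2.2.2.1 k'| ≤ η)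
    (h5 : |p.2.2.2.2.2 - p'.2.2.2.2.2| ≤ η) :
    |axisNetEval γ p x - axisNetEval γ p' x|
      ≤ B * (γ * (m * (B * η + η) + η)) + K * η + η := by
  have hη : 0 ≤ η := (abs_nonneg _).trans h5
  set u := fun k => Real.tanh ((p.2.1 k).1 * x (p.1 k) + (p.2.1 k).2)
  set u' := fun k => Real.tanh ((p'.2.1 k).1 * x (p'.1 k) + (p'.2.1 k).2)
  set v := fun k' => Real.tanh (γ * (∑ k, p.2.2.1 k k' * u k + p.2.2.2.1 k'))
  set v' := fun k' => Real.tanh (γ * (∑ k, p'.2.2.1 k k' * u' k + p'.2.2.2.1 k'))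
  set α := γ * (m * (B * η + η) + η) with hα
  have hv : ∀ k', |v k' - v' k'| ≤ α := by
    intro k'
    refine (abs_tanh_sub_tanh_le _ _).trans ?_
    rw [← mul_sub, abs_mul, abs_of_nonneg hγ]
    have : ∑ k, p.2.2.1 k k' * u k + p.2.2.2.1 k' - (∑ k, p'.2.2.1 k k' * u' k + p'.2.2.2.1 k')
        = ∑ k, (p.2.2.1 k k' * u k - p'.2.2.1 k k' * u' k)
          + (p.2.2.2.1 k' - p'.2.2.2.1 k') := by
      rw [Finset.sum_sub_distrib]
      ring
    rw [this, hα]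
    refine mul_le_mul_of_nonneg_left ((abs_add_le _ _).trans (add_le_add ?_ (h3 k'))) hγ
    refine (Finset.abs_sum_le_sum_abs _ _).trans ?_
    calc _ ≤ ∑ _k : Fin m, (B * η + η) := Finset.sum_le_sum fun k _ =>
          abs_mul_sub_mul_le (hp.1 k k') (Real.abs_tanh_lt_one _).le (h1 k) (h2 k k')
      _ = _ := by
          rw [Finset.sum_const, Finset.card_univ, Fintype.card_fin, nsmul_eq_mul]
  have hsum : axisNetEval γ p x - axisNetEval γ p' x
      = ∑ k', (p.2.2.2.2.1 k' * v k' - p'.2.2.2.2.1 k' * v' k')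
        + (p.2.2.2.2.2 - p'.2.2.2.2.2) := by
    rw [Finset.sum_sub_distrib]
    simp only [axisNetEval, v, v', u, u']
    ring
  rw [hsum]
  refine (abs_add_le _ _).trans (add_le_add ?_ h5)
  refine (Finset.abs_sum_le_sum_abs _ _).trans ?_
  have hα0 : 0 ≤ α := by positivity
  calc _ ≤ ∑ k', (|p.2.2.2.2.1 k'| * α + η) := Finset.sum_le_sum fun k' _ =>
        abs_mul_sub_mul_le le_rfl (Real.abs_tanh_lt_one _).le (hv k') (h4 k')
    _ = (∑ k', |p.2.2.2.2.1 k'|) * α + K * η := by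
        rw [Finset.sum_add_distrib, Finset.sum_mul]
        simp
    _ ≤ B * α + K * η := by
        gcongr
        linarith [hp.2.2, abs_nonneg p.2.2.2.2.2]

/-- The number of codes for the networks with bounded parameters on a sample of size `n`. -/
def axisNetCodeCard (d m K n g₁ g₂ : ℕ) : ℕ :=
  d ^ m * (((n + 1) * 2) ^ 2 * n ^ 2 * g₁ ^ 2) ^ m * g₂ ^ (m * K + 2 * K + 1)

/-- On a sample of size `n`, the networks with bounded parameters have a finite cover. -/
theorem exists_axisNet_cover {d m K n : ℕ} (hn : 0 < n) {γ B η : ℝ} (hγ : 0 ≤ γ) (hB : 0 ≤ B)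
    (hη : 0 < η) (x : Fin n → Fin d → ℝ) :
    ∃ code : AxisNetParams d m K →
        Fin (axisNetCodeCard d m K n (⌊2 * (1 / η) / η⌋₊ + 1) (⌊2 * B / η⌋₊ + 1)),
      ∀ p ∈ boundedAxisNetParams d m K B, ∀ p' ∈ boundedAxisNetParams d m K B,
        code p = code p' → ∀ i, |axisNetEval γ p (x i) - axisNetEval γ p' (x i)|
          ≤ B * (γ * (m * (B * η + η) + η)) + K * η + η := by
  set g₁ := ⌊2 * (1 / η) / η⌋₊ + 1
  set g₂ := ⌊2 * B / η⌋₊ + 1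
  choose c₁ hc₁ using fun j : Fin d => exists_affineCode hn (fun i => x i j) hη
  let ι : Type := (Fin m → Fin d) × (Fin m → AffineCode n g₁) × (Fin m → Fin K → Fin g₂) ×
    (Fin K → Fin g₂) × (Fin K → Fin g₂) × Fin g₂
  have hcard : Fintype.card ι = axisNetCodeCard d m K n g₁ g₂ := by
    simp only [ι, axisNetCodeCard, Fintype.card_prod, Fintype.card_fun, Fintype.card_fin,
      Fintype.card_option, Fintype.card_bool]
    have e1 : (n + 1) * 2 * ((n + 1) * 2 * (n * n * (g₁ * g₁)))
        = ((n + 1) * 2) ^ 2 * n ^ 2 * g₁ ^ 2 := by ring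
    rw [e1]
    ring
  let code : AxisNetParams d m K → ι := fun p =>
    (p.1, fun k => c₁ (p.1 k) (p.2.1 k), fun k k' => gridCode B η (p.2.2.1 k k'),
      fun k' => gridCode B η (p.2.2.2.1 k'), fun k' => gridCode B η (p.2.2.2.2.1 k'),
      gridCode B η p.2.2.2.2.2)
  refine ⟨fun p => Fintype.equivFinOfCardEq hcard (code p), fun p hp p' hp' h i => ?_⟩
  have h := (Fintype.equivFinOfCardEq hcard).injective h
  simp only [code, ι, Prod.mk.injEq] at h
  obtain ⟨hj, h1, h2, h3, h4, h5⟩ := h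
  have hb : ∀ {q : AxisNetParams d m K}, q ∈ boundedAxisNetParams d m K B →
      (∀ k', |q.2.2.2.2.1 k'| ≤ B) ∧ |q.2.2.2.2.2| ≤ B := by
    intro q hq
    have hs := hq.2.2
    have h0 : 0 ≤ ∑ k', |q.2.2.2.2.1 k'| := Finset.sum_nonneg fun k _ => abs_nonneg _
    refine ⟨fun k' => ?_, by linarith⟩
    have := Finset.single_le_sum (f := fun k' => |q.2.2.2.2.1 k'|) (fun k _ => abs_nonneg _)
      (Finset.mem_univ k')
    have h2 := abs_nonneg q.2.2.2.2.2
    linarith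
  refine abs_axisNetEval_sub_le hγ hB hp (x i) (fun k => ?_)
    (fun k k' => abs_sub_le_of_gridCode_eq hη (hp.1 k k') (hp'.1 k k')
      (congrFun (congrFun h2 k) k'))
    (fun k' => abs_sub_le_of_gridCode_eq hη (hp.2.1 k') (hp'.2.1 k') (congrFun h3 k'))
    (fun k' => abs_sub_le_of_gridCode_eq hη ((hb hp).1 k') ((hb hp').1 k') (congrFun h4 k'))
    (abs_sub_le_of_gridCode_eq hη (hb hp).2 (hb hp').2 h5)
  have hk := congrFun h1 k
  rw [← hj] at hk ⊢
  exact hc₁ _ _ _ hk i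

/-- Numbering the nodes removes the tree: only the cut directions survive, as a map `Fin (K - 1) →
Fin d`. The factor `γ₁` is absorbed by the unbounded first-layer weights, and full connection of the
second layer only enlarges the class. -/
theorem networkClass_subset_axisNet {d K : ℕ} (γ₁ γ₂ C : ℝ) (t : SplitTree (Fin d × ℝ))
    (ht : t.numLeaves = K) {f : (Fin d → ℝ) → ℝ} (hf : f ∈ networkClass γ₁ γ₂ C t) :
    ∃ p ∈ boundedAxisNetParams d (K - 1) K (C * K), f = axisNetEval γ₂ p := by
  obtain ⟨q, ⟨h1, -, h3⟩, rfl⟩ := hf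
  have hcard := t.card_inner_add_one
  have eI : t.Inner ≃ Fin (K - 1) := Fintype.equivFinOfCardEq (by omega)
  have eL : t.Leaf ≃ Fin K := Fintype.equivFinOfCardEq ht
  rw [ht] at h3
  have n1 : 0 ≤ ‖fun (k : t.Inner) (k' : t.Leaf) => q.W₂ k k'‖ := norm_nonneg _
  have n2 : 0 ≤ ‖q.b₂‖ := norm_nonneg _
  have n3 : 0 ≤ ∑ k', |q.Wout k'| := Finset.sum_nonneg fun _ _ => abs_nonneg _
  have n4 : 0 ≤ |q.bout| := abs_nonneg _
  refine ⟨(fun k => (t.label (eI.symm k)).1,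
    fun k => (γ₁ * q.W₁ (t.label (eI.symm k)).1 (eI.symm k), γ₁ * q.b₁ (eI.symm k)),
    fun k k' => q.W₂ (eI.symm k) (eL.symm k'), fun k' => q.b₂ (eL.symm k'),
    fun k' => q.Wout (eL.symm k'), q.bout), ⟨fun k k' => ?_, fun k' => ?_, ?_⟩, ?_⟩
  · have a1 := norm_le_pi_norm (fun (k : t.Inner) (k' : t.Leaf) => q.W₂ k k') (eI.symm k)
    have a2 := norm_le_pi_norm (fun (k' : t.Leaf) => q.W₂ (eI.symm k) k') (eL.symm k')
    have a3 : |q.W₂ (eI.symm k) (eL.symm k')|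
        ≤ ‖fun (k : t.Inner) (k' : t.Leaf) => q.W₂ k k'‖ := a2.trans a1
    change |q.W₂ (eI.symm k) (eL.symm k')| ≤ _
    linarith
  · have a1 : |q.b₂ (eL.symm k')| ≤ ‖q.b₂‖ := norm_le_pi_norm q.b₂ (eL.symm k')
    change |q.b₂ (eL.symm k')| ≤ _
    linarith
  · have a1 : ∑ k', |q.Wout (eL.symm k')| = ∑ k', |q.Wout k'| :=
      Equiv.sum_comp eL.symm fun k' => |q.Wout k'|
    change ∑ k', |q.Wout (eL.symm k')| + |q.bout| ≤ _
    linarith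
  · funext x
    have hW : ∀ k, ∑ j, q.W₁ j k * x j = q.W₁ (t.label k).1 k * x (t.label k).1 := by
      intro k
      refine Finset.sum_eq_single _ (fun j _ hj => ?_) (by simp)
      rw [h1 j k (fun h => hj h.symm), zero_mul]
    simp only [NetParams.eval, axisNetEval, Matrix.mulVec, dotProduct, Matrix.transpose_apply,
      Pi.add_apply, hW]
    congr 1
    rw [← Equiv.sum_comp eL.symm]
    refine Finset.sum_congr rfl fun k' _ => ?_
    rw [← Equiv.sum_comp eI.symm]
    congr 4
    refine Finset.sum_congr rfl fun k _ => ?_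
    congr 2
    ring

/-! ### Continuity in the parameters, the centred loss, and countable reduction. -/

theorem continuous_axisNetEval_params {d m K : ℕ} (γ : ℝ) (x : Fin d → ℝ) :
    Continuous fun p : AxisNetParams d m K => axisNetEval γ p x := by
  have hx : ∀ k : Fin m, Continuous fun p : AxisNetParams d m K => x (p.1 k) := fun k =>
    (continuous_of_discreteTopology (f := x)).comp ((continuous_apply k).comp continuous_fst)
  have ht := continuous_real_tanh
  unfold axisNetEval
  fun_prop

theorem continuous_axisNetEval {d m K : ℕ} (γ : ℝ) (p : AxisNetParams d m K) :
    Continuous (axisNetEval γ p) := by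
  have ht := continuous_real_tanh
  unfold axisNetEval
  fun_prop

/-- The squared error of the prediction `f x` of `y`, up to the term `y ^ 2`. -/
def centeredLoss {d : ℕ} (f : (Fin d → ℝ) → ℝ) (z : (Fin d → ℝ) × ℝ) : ℝ :=
  f z.1 ^ 2 - 2 * z.2 * f z.1

theorem abs_centeredLoss_le {d : ℕ} {f : (Fin d → ℝ) → ℝ} {B : ℝ} (hf : ∀ x, |f x| ≤ B)
    (z : (Fin d → ℝ) × ℝ) : |centeredLoss f z| ≤ B ^ 2 + 2 * |z.2| * B := by
  have h := hf z.1
  have h0 := abs_nonneg (f z.1)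
  refine (abs_sub _ _).trans (add_le_add ?_ ?_)
  · rw [abs_pow]
    gcongr
  · rw [abs_mul, abs_mul, abs_two]
    gcongr

theorem centeredLoss_sq_le {d : ℕ} {f : (Fin d → ℝ) → ℝ} {B : ℝ} (hf : ∀ x, |f x| ≤ B)
    (z : (Fin d → ℝ) × ℝ) : centeredLoss f z ^ 2 ≤ 8 * B ^ 2 * z.2 ^ 2 + 2 * B ^ 4 := by
  have h := abs_centeredLoss_le hf z
  have h1 : centeredLoss f z ^ 2 ≤ (B ^ 2 + 2 * |z.2| * B) ^ 2 := by
    rw [← sq_abs]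
    gcongr
  have h2 := sq_abs z.2
  -- This is `(a + b)² ≤ 2 a² + 2 b²`.
  nlinarith [sq_nonneg (B ^ 2 - 2 * |z.2| * B)]

theorem abs_centeredLoss_sub_le {d : ℕ} {f g : (Fin d → ℝ) → ℝ} {B δ : ℝ} (hf : ∀ x, |f x| ≤ B)
    (hg : ∀ x, |g x| ≤ B) (z : (Fin d → ℝ) × ℝ) (h : |f z.1 - g z.1| ≤ δ) :
    |centeredLoss f z - centeredLoss g z| ≤ δ * (2 * |z.2| + 2 * B) := by
  have h1 : centeredLoss f z - centeredLoss g z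
      = (f z.1 - g z.1) * (f z.1 + g z.1 - 2 * z.2) := by
    unfold centeredLoss
    ring
  rw [h1, abs_mul]
  have h2 : |f z.1 + g z.1 - 2 * z.2| ≤ 2 * |z.2| + 2 * B := by
    refine (abs_sub _ _).trans ?_
    have a1 := abs_add_le (f z.1) (g z.1)
    have a2 := hf z.1
    have a3 := hg z.1
    rw [abs_mul, abs_two]
    linarith
  exact mul_le_mul h h2 (abs_nonneg _) ((abs_nonneg _).trans h)

theorem measurable_centeredLoss {d : ℕ} {f : (Fin d → ℝ) → ℝ} (hf : Measurable f) :
    Measurable (centeredLoss f) := by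
  unfold centeredLoss
  fun_prop

/-- For each `z`, the parameters whose value is at most the countable supremum form a closed set
containing a dense one. The dense set is chosen independently of `z`, so the resulting supremum is
one measurable function of the sample. -/
theorem exists_countable_forall_le_iSup {P Z : Type*} [TopologicalSpace P]
    [SecondCountableTopology P] (A : Set P) (G : P → Z → ENNReal)
    (hG : ∀ z, Continuous fun p : A => G p z) :
    ∃ s : Set P, s.Countable ∧ s ⊆ A ∧ ∀ p ∈ A, ∀ z, G p z ≤ ⨆ q : s, G q z := by
  obtain ⟨s, hs, hd⟩ := TopologicalSpace.exists_countable_dense A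
  refine ⟨Subtype.val '' s, hs.image _, by simp, fun p hp z => ?_⟩
  have hclosed := isClosed_le (hG z) (continuous_const (y := ⨆ q : (Subtype.val '' s : Set P), G q z))
  have hsub : s ⊆ {p : A | G p z ≤ ⨆ q : (Subtype.val '' s : Set P), G q z} := fun q hq =>
    le_iSup (fun q : (Subtype.val '' s : Set P) => G q z) ⟨q.1, q, hq, rfl⟩
  have := hclosed.closure_subset_iff.2 hsub
  rw [hd.closure_eq] at this
  exact this (Set.mem_univ (⟨p, hp⟩ : A))

theorem continuous_centeredLoss_deviation {d m K n : ℕ} (γ B : ℝ)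
    (ν : Measure ((Fin d → ℝ) × ℝ)) [IsProbabilityMeasure ν] (hν : Integrable (fun z => z.2) ν)
    (z : Fin n → (Fin d → ℝ) × ℝ) :
    Continuous fun p : boundedAxisNetParams d m K B =>
      ENNReal.ofReal |∑ i, centeredLoss (axisNetEval γ p.1) (z i)
        - n * ∫ x, centeredLoss (axisNetEval γ p.1) x ∂ν| := by
  have hcl : ∀ z : (Fin d → ℝ) × ℝ,
      Continuous fun p : boundedAxisNetParams d m K B => centeredLoss (axisNetEval γ p.1) z := by
    intro z
    have : Continuous fun p : boundedAxisNetParams d m K B => axisNetEval γ p.1 z.1 :=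
      (continuous_axisNetEval_params γ z.1).comp continuous_subtype_val
    exact (this.pow 2).sub (continuous_const.mul this)
  have hint : Continuous fun p : boundedAxisNetParams d m K B =>
      ∫ x, centeredLoss (axisNetEval γ p.1) x ∂ν := by
    refine continuous_of_dominated (bound := fun z => B ^ 2 + 2 * |z.2| * B) (fun p => ?_)
      (fun p => ae_of_all _ fun z => ?_) ?_ (ae_of_all _ hcl)
    · exact (measurable_centeredLoss (continuous_axisNetEval γ p.1).measurable).aestronglyMeasurable
    · exact abs_centeredLoss_le (abs_axisNetEval_le p.2) z
    · exact (integrable_const _).add ((hν.abs.const_mul 2).mul_const B)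
  refine ENNReal.continuous_ofReal.comp (Continuous.abs ?_)
  exact (continuous_finsetSum _ fun i _ => hcl (z i)).sub (continuous_const.mul hint)

/-! ### The deviation bound for a fixed sample size. -/

/-- A bound for the largest deviation of the empirical risk from the risk, uniformly over the
networks with bounded parameters. -/
theorem lintegral_iSup_axisNet_deviation_le {d m K n : ℕ} (hn : 0 < n)
    {Ω : Type*} [MeasurableSpace Ω] (μ : Measure Ω) [IsProbabilityMeasure μ]
    (X : Ω → Fin d → ℝ) (Y : Ω → ℝ) (hY : MemLp Y 2 μ)
    (D : ℕ → Ω → (Fin d → ℝ) × ℝ) (hD_indep : iIndepFun D μ)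
    (hD_law : ∀ i, IdentDistrib (D i) (fun ω => (X ω, Y ω)) μ μ)
    {γ B η l N δ : ℝ} (hγ : 0 ≤ γ) (hB : 0 ≤ B) (hη : 0 < η) (hl : 0 < l) (hN1 : 1 ≤ N)
    (hN : (axisNetCodeCard d m K n (⌊2 * (1 / η) / η⌋₊ + 1) (⌊2 * B / η⌋₊ + 1) : ℝ) ≤ N)
    (hδ : B * (γ * (m * (B * η + η) + η)) + K * η + η ≤ δ) :
    ∫⁻ ω, ⨆ p ∈ boundedAxisNetParams d m K B, ENNReal.ofReal
        |empiricalRisk (fun i : Fin n => D i ω) (axisNetEval γ p)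
          - trueRisk μ X Y (axisNetEval γ p)| ∂μ
      ≤ ∫⁻ ω, ENNReal.ofReal |1 / (n : ℝ) * ∑ i : Fin n, (D i ω).2 ^ 2 - ∫ ω, Y ω ^ 2 ∂μ| ∂μ
        + ENNReal.ofReal (2 * (Real.log (2 * N) / (l * n)
          + l / 2 * (8 * B ^ 2 * ∫ ω, Y ω ^ 2 ∂μ + 2 * B ^ 4)
          + δ * (2 * ∫ ω, |Y ω| ∂μ + 2 * B))) := by
  have hXY : AEMeasurable (fun ω => (X ω, Y ω)) μ := (hD_law 0).aemeasurable_snd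
  set ν := μ.map fun ω => (X ω, Y ω) with hν
  have : IsProbabilityMeasure ν := Measure.isProbabilityMeasure_map hXY
  have hY1 : Integrable Y μ := hY.integrable one_le_two
  have hY2 : Integrable (fun ω => Y ω ^ 2) μ := hY.integrable_sq
  have hmap : ∀ {g : (Fin d → ℝ) × ℝ → ℝ}, Measurable g →
      (Integrable g ν ↔ Integrable (fun ω => g (X ω, Y ω)) μ) := fun hg =>
    integrable_map_measure hg.aestronglyMeasurable hXY
  have hval : ∀ {g : (Fin d → ℝ) × ℝ → ℝ}, Measurable g →
      ∫ z, g z ∂ν = ∫ ω, g (X ω, Y ω) ∂μ := fun hg =>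
    integral_map hXY hg.aestronglyMeasurable
  have hi1 : Integrable (fun z : (Fin d → ℝ) × ℝ => z.2) ν := (hmap measurable_snd).2 hY1
  have hi2 : Integrable (fun z : (Fin d → ℝ) × ℝ => z.2 ^ 2) ν :=
    (hmap (measurable_snd.pow_const 2)).2 hY2
  have hv2 : ∫ z : (Fin d → ℝ) × ℝ, z.2 ^ 2 ∂ν = ∫ ω, Y ω ^ 2 ∂μ :=
    hval (measurable_snd.pow_const 2)
  have hv1 : ∫ z : (Fin d → ℝ) × ℝ, |z.2| ∂ν = ∫ ω, |Y ω| ∂μ := hval measurable_snd.abs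
  have hDm : ∀ i, AEMeasurable (D i) μ := fun i => (hD_law i).aemeasurable_fst
  have hpi : μ.map (fun ω (i : Fin n) => D i ω) = Measure.pi fun _ : Fin n => ν := by
    have h1 : iIndepFun (fun (i : Fin n) => D i) μ := hD_indep.precomp Fin.val_injective
    rw [(iIndepFun_iff_map_fun_eq_pi_map fun i => hDm _).1 h1]
    congr 1
    funext i
    exact (hD_law i).map_eq
  obtain ⟨s, hsc, hsA, hs⟩ := exists_countable_forall_le_iSup (boundedAxisNetParams d m K B)
    (fun p (z : Fin n → (Fin d → ℝ) × ℝ) =>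
      ENNReal.ofReal |∑ i, centeredLoss (axisNetEval γ p) (z i)
        - n * ∫ x, centeredLoss (axisNetEval γ p) x ∂ν|)
    (continuous_centeredLoss_deviation (n := n) γ B ν hi1)
  have := hsc.to_subtype
  set F : (Fin n → (Fin d → ℝ) × ℝ) → ENNReal := fun z => ⨆ q : s,
    ENNReal.ofReal |∑ i, centeredLoss (axisNetEval γ q.1) (z i)
      - n * ∫ x, centeredLoss (axisNetEval γ q.1) x ∂ν| with hF
  have hlm : ∀ p : AxisNetParams d m K, Measurable (centeredLoss (axisNetEval γ p)) := fun p =>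
    measurable_centeredLoss (continuous_axisNetEval γ p).measurable
  have hFm : Measurable F := by
    refine Measurable.iSup fun q => ?_
    have := hlm q.1
    fun_prop
  have hδ0 : 0 ≤ δ := le_trans (by positivity) hδ
  have hn' : (0 : ℝ) < n := by exact_mod_cast hn
  have hmax := lintegral_iSup_deviation_le (n := n) ν
    (fun q : s => centeredLoss (axisNetEval γ q.1)) (fun q => hlm q.1)
    (fun z => 8 * B ^ 2 * z.2 ^ 2 + 2 * B ^ 4) (fun z => δ * (2 * |z.2| + 2 * B))
    (fun q z => centeredLoss_sq_le (abs_axisNetEval_le (hsA q.2)) z)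
    ((hi2.const_mul _).add (integrable_const _))
    (((hi1.abs.const_mul 2).add (integrable_const _)).const_mul δ)
    (fun z => by positivity) N hN1
    (fun z => by
      obtain ⟨code, hcode⟩ := exists_axisNet_cover (m := m) (K := K) hn hγ hB hη fun i => (z i).1
      refine ⟨_, fun q => code q.1, hN, fun q q' h i => ?_⟩
      exact abs_centeredLoss_sub_le (abs_axisNetEval_le (hsA q.2)) (abs_axisNetEval_le (hsA q'.2))
        _ ((hcode _ (hsA q.2) _ (hsA q'.2) h i).trans hδ)) l hl
  have e1 : ∫ z : (Fin d → ℝ) × ℝ, (8 * B ^ 2 * z.2 ^ 2 + 2 * B ^ 4) ∂ν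
      = 8 * B ^ 2 * ∫ ω, Y ω ^ 2 ∂μ + 2 * B ^ 4 := by
    rw [integral_add (hi2.const_mul _) (integrable_const _), integral_const_mul, hv2]
    simp
  have e2 : ∫ z : (Fin d → ℝ) × ℝ, δ * (2 * |z.2| + 2 * B) ∂ν
      = δ * (2 * ∫ ω, |Y ω| ∂μ + 2 * B) := by
    rw [integral_const_mul, integral_add (hi1.abs.const_mul 2) (integrable_const _),
      integral_const_mul, hv1]
    simp
  rw [e1, e2] at hmax
  have hrisk : ∀ p ∈ boundedAxisNetParams d m K B, trueRisk μ X Y (axisNetEval γ p)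
      = ∫ ω, Y ω ^ 2 ∂μ + ∫ z, centeredLoss (axisNetEval γ p) z ∂ν := by
    intro p hp
    have hci : Integrable (centeredLoss (axisNetEval γ p)) ν :=
      Integrable.mono' ((integrable_const (B ^ 2)).add ((hi1.abs.const_mul 2).mul_const B))
        (hlm p).aestronglyMeasurable
        (ae_of_all _ fun z => abs_centeredLoss_le (abs_axisNetEval_le hp) z)
    rw [hval (hlm p), ← integral_add hY2 ((hmap (hlm p)).1 hci)]
    refine integral_congr_ae (ae_of_all _ fun ω => ?_)
    simp only [centeredLoss, sq_abs]
    ring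
  -- The `Y²` part leaves the supremum, and the rest is dominated by the measurable `F`, so the
  -- uncountable supremum need not be measurable.
  have hpt : ∀ ω, ⨆ p ∈ boundedAxisNetParams d m K B, ENNReal.ofReal
        |empiricalRisk (fun i : Fin n => D i ω) (axisNetEval γ p)
          - trueRisk μ X Y (axisNetEval γ p)|
      ≤ ENNReal.ofReal |1 / (n : ℝ) * ∑ i : Fin n, (D i ω).2 ^ 2 - ∫ ω, Y ω ^ 2 ∂μ|
        + ENNReal.ofReal (1 / n) * F fun i => D i ω := by
    intro ω
    refine iSup₂_le fun p hp => ?_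
    refine le_trans ?_ (add_le_add le_rfl (mul_le_mul_right (hs p hp fun i => D i ω) _))
    rw [← ENNReal.ofReal_mul (by positivity), ← ENNReal.ofReal_add (abs_nonneg _) (by positivity)]
    refine ENNReal.ofReal_le_ofReal ?_
    have h1 : empiricalRisk (fun i : Fin n => D i ω) (axisNetEval γ p)
          - trueRisk μ X Y (axisNetEval γ p)
        = (1 / (n : ℝ) * ∑ i : Fin n, (D i ω).2 ^ 2 - ∫ ω, Y ω ^ 2 ∂μ)
          + 1 / n * (∑ i : Fin n, centeredLoss (axisNetEval γ p) (D i ω)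
            - n * ∫ x, centeredLoss (axisNetEval γ p) x ∂ν) := by
      rw [hrisk p hp, empiricalRisk]
      have h2 : ∑ i : Fin n, |(D i ω).2 - axisNetEval γ p (D i ω).1| ^ 2
          = ∑ i : Fin n, (D i ω).2 ^ 2 + ∑ i : Fin n, centeredLoss (axisNetEval γ p) (D i ω) := by
        rw [← Finset.sum_add_distrib]
        refine Finset.sum_congr rfl fun i _ => ?_
        simp only [centeredLoss, sq_abs]
        ring
      rw [h2]
      field_simp
      ring
    rw [h1]
    refine (abs_add_le _ _).trans ?_
    rw [abs_mul (1 / (n : ℝ)), abs_of_pos (show (0 : ℝ) < 1 / n by positivity)]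
  refine (lintegral_mono hpt).trans ?_
  have hDm2 : ∀ i, AEMeasurable (fun ω => (D i ω).2) μ := fun i =>
    measurable_snd.comp_aemeasurable (hDm i)
  rw [lintegral_add_left' (by fun_prop)]
  gcongr
  rw [lintegral_const_mul' _ _ ENNReal.ofReal_ne_top,
    ← lintegral_map' (f := F) (g := fun ω (i : Fin n) => D i ω) hFm.aemeasurable
      (aemeasurable_pi_lambda _ fun i => hDm _), hpi]
  refine (mul_le_mul_right hmax _).trans ?_
  rw [← mul_assoc, mul_comm (ENNReal.ofReal (1 / n)) 2, mul_assoc,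
    ← ENNReal.ofReal_mul (by positivity), ENNReal.ofReal_mul (by positivity : (0 : ℝ) ≤ 2)]
  simp only [ENNReal.ofReal_ofNat]
  gcongr
  apply le_of_eq
  field_simp

/-! ### Asymptotics and choice of the constants. -/

theorem tendsto_lintegral_abs_mean_sq_sub {d : ℕ} {Ω : Type*} [MeasurableSpace Ω]
    (μ : Measure Ω) [IsProbabilityMeasure μ]
    (X : Ω → Fin d → ℝ) (Y : Ω → ℝ) (hY : MemLp Y 2 μ)
    (D : ℕ → Ω → (Fin d → ℝ) × ℝ) (hD_indep : iIndepFun D μ)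
    (hD_law : ∀ i, IdentDistrib (D i) (fun ω => (X ω, Y ω)) μ μ) :
    Tendsto (fun n : ℕ => ∫⁻ ω,
      ENNReal.ofReal |1 / (n : ℝ) * ∑ i : Fin n, (D i ω).2 ^ 2 - ∫ ω, Y ω ^ 2 ∂μ| ∂μ)
      atTop (𝓝 0) := by
  have hg : Measurable fun z : (Fin d → ℝ) × ℝ => z.2 ^ 2 := measurable_snd.pow_const 2
  have hlaw : ∀ i, IdentDistrib (fun ω => (D i ω).2 ^ 2) (fun ω => Y ω ^ 2) μ μ := fun i =>
    (hD_law i).comp hg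
  have h := strong_law_Lp (μ := μ) (p := 1) le_rfl (by simp) (fun i ω => (D i ω).2 ^ 2)
    ((hlaw 0).symm.memLp_snd (memLp_one_iff_integrable.2 hY.integrable_sq))
    (fun i j hij => (hD_indep.indepFun hij).comp hg hg)
    (fun i => (hlaw i).trans (hlaw 0).symm)
  refine h.congr fun n => ?_
  rw [eLpNorm_one_eq_lintegral_enorm]
  refine lintegral_congr fun ω => ?_
  rw [Real.enorm_eq_ofReal_abs, (hlaw 0).integral_eq, smul_eq_mul, Finset.sum_range, one_div]

/-- Here `K⁵ ≤ n^(5/6)` and `log n = o(n^(1/6))`. This controls the cost `K log n` of the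
sample-dependent codes, multiplied by the `K⁴ / n` of the final rate. -/
theorem tendsto_pow_five_mul_log_div {K : ℕ → ℕ} (hK : ∀ᶠ n in atTop, (K n : ℝ) ^ 6 ≤ n) :
    Tendsto (fun n : ℕ => (K n : ℝ) ^ 5 * Real.log n / n) atTop (𝓝 0) := by
  have h := (isLittleO_log_rpow_atTop (show (0 : ℝ) < 1 / 6 by norm_num)).tendsto_div_nhds_zero
  have h1 := h.comp tendsto_natCast_atTop_atTop
  refine squeeze_zero' (Eventually.of_forall fun n => ?_) ?_ h1
  · have := Real.log_natCast_nonneg n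
    positivity
  · filter_upwards [hK, eventually_ge_atTop 1] with n hn h1n
    have hn0 : (0 : ℝ) < n := by exact_mod_cast h1n
    have hlog := Real.log_natCast_nonneg n
    have h5 : (K n : ℝ) ^ 5 ≤ (n : ℝ) ^ (5 / 6 : ℝ) := by
      have h6 : (K n : ℝ) ^ 5 = ((K n : ℝ) ^ 6) ^ (5 / 6 : ℝ) := by
        rw [← Real.rpow_natCast, ← Real.rpow_natCast, ← Real.rpow_mul (by positivity)]
        norm_num
      rw [h6]
      exact Real.rpow_le_rpow (by positivity) hn (by norm_num)
    have hsplit : (n : ℝ) = (n : ℝ) ^ (5 / 6 : ℝ) * (n : ℝ) ^ (1 / 6 : ℝ) := by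
      rw [← Real.rpow_add hn0]
      norm_num
    have hp : (0 : ℝ) < (n : ℝ) ^ (5 / 6 : ℝ) := Real.rpow_pos_of_pos hn0 _
    have hq : (0 : ℝ) < (n : ℝ) ^ (1 / 6 : ℝ) := Real.rpow_pos_of_pos hn0 _
    simp only [Function.comp]
    rw [div_le_div_iff₀ hn0 hq]
    calc (K n : ℝ) ^ 5 * Real.log n * (n : ℝ) ^ (1 / 6 : ℝ)
        ≤ (n : ℝ) ^ (5 / 6 : ℝ) * Real.log n * (n : ℝ) ^ (1 / 6 : ℝ) := by gcongr
      _ = Real.log n * ((n : ℝ) ^ (5 / 6 : ℝ) * (n : ℝ) ^ (1 / 6 : ℝ)) := by ring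
      _ = Real.log n * n := by rw [← hsplit]

theorem axisNetCodeCard_le {d m K n : ℕ} (hm : m ≤ K) (hK : 1 ≤ K) (hn : 1 ≤ n) {C G : ℝ}
    (hC : 0 ≤ C) (hKG : (K : ℝ) ≤ G) :
    (axisNetCodeCard d m K n (⌊2 * (1 / (1 / G)) / (1 / G)⌋₊ + 1)
      (⌊2 * (C * K) / (1 / G)⌋₊ + 1) : ℝ)
      ≤ ((d : ℝ) + 1) ^ K * (144 * n ^ 4 * G ^ 4) ^ K * ((2 * C + 1) * G ^ 2) ^ (4 * K ^ 2) := by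
  have hK' : (1 : ℝ) ≤ K := by exact_mod_cast hK
  have hn' : (1 : ℝ) ≤ n := by exact_mod_cast hn
  have hG : 1 ≤ G := hK'.trans hKG
  have hG2 : 1 ≤ G ^ 2 := one_le_pow₀ hG
  have g1 : ((⌊2 * (1 / (1 / G)) / (1 / G)⌋₊ + 1 : ℕ) : ℝ) ≤ 3 * G ^ 2 := by
    have e : 2 * (1 / (1 / G)) / (1 / G) = 2 * G ^ 2 := by field_simp
    rw [e]
    push_cast
    have := Nat.floor_le (show 0 ≤ 2 * G ^ 2 by positivity)
    linarith
  have g2 : ((⌊2 * (C * K) / (1 / G)⌋₊ + 1 : ℕ) : ℝ) ≤ (2 * C + 1) * G ^ 2 := by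
    have e : 2 * (C * K) / (1 / G) = 2 * C * (K * G) := by field_simp
    rw [e]
    push_cast
    have h1 := Nat.floor_le (show 0 ≤ 2 * C * (K * G) by positivity)
    have h2 : K * G ≤ G ^ 2 := by nlinarith
    nlinarith
  have hb1 : ((((n : ℝ) + 1) * 2) ^ 2 * n ^ 2
      * ((⌊2 * (1 / (1 / G)) / (1 / G)⌋₊ + 1 : ℕ) : ℝ) ^ 2) ≤ 144 * n ^ 4 * G ^ 4 := by
    -- Hence `144 = 16 * 9`.
    calc _ ≤ (((n : ℝ) + n) * 2) ^ 2 * n ^ 2 * (3 * G ^ 2) ^ 2 := by gcongr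
      _ = _ := by ring
  have hbase1 : 1 ≤ 144 * (n : ℝ) ^ 4 * G ^ 4 := by
    have a1 : 1 ≤ (n : ℝ) ^ 4 := one_le_pow₀ hn'
    have a2 : 1 ≤ G ^ 4 := one_le_pow₀ hG
    nlinarith
  have hbase2 : 1 ≤ (2 * C + 1) * G ^ 2 := by nlinarith
  have hexp : m * K + 2 * K + 1 ≤ 4 * K ^ 2 := by nlinarith
  unfold axisNetCodeCard
  rw [Nat.cast_mul, Nat.cast_mul, Nat.cast_pow, Nat.cast_pow, Nat.cast_pow]
  have i1 : (d : ℝ) ^ m ≤ ((d : ℝ) + 1) ^ K :=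
    (pow_le_pow_left₀ (by positivity) (by linarith) m).trans
      (pow_le_pow_right₀ (by linarith [(Nat.cast_nonneg d : (0 : ℝ) ≤ d)]) hm)
  have i2 : (((((n + 1) * 2) ^ 2 * n ^ 2
      * (⌊2 * (1 / (1 / G)) / (1 / G)⌋₊ + 1) ^ 2 : ℕ)) : ℝ) ^ m ≤ (144 * n ^ 4 * G ^ 4) ^ K := by
    refine (pow_le_pow_left₀ (by positivity) ?_ m).trans (pow_le_pow_right₀ hbase1 hm)
    push_cast at hb1 ⊢
    exact hb1
  have i3 : (((⌊2 * (C * K) / (1 / G)⌋₊ + 1 : ℕ)) : ℝ) ^ (m * K + 2 * K + 1)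
      ≤ ((2 * C + 1) * G ^ 2) ^ (4 * K ^ 2) :=
    (pow_le_pow_left₀ (by positivity) g2 _).trans (pow_le_pow_right₀ hbase2 hexp)
  gcongr

theorem log_axisNet_cover_le {d K n : ℕ} (hK : 1 ≤ K) (hn : 1 ≤ n) {C G : ℝ} (hC : 0 ≤ C)
    (hG : 1 ≤ Real.log G) (hG0 : 0 < G) :
    Real.log (2 * (((d : ℝ) + 1) ^ K * (144 * n ^ 4 * G ^ 4) ^ K
        * ((2 * C + 1) * G ^ 2) ^ (4 * K ^ 2)))
      ≤ (Real.log 2 + Real.log (d + 1) + Real.log 144 + 12 + 4 * Real.log (2 * C + 1))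
        * (K ^ 2 * Real.log G) + 4 * (K * Real.log n) := by
  have hn0 : (0 : ℝ) < n := by exact_mod_cast hn
  have hK' : (1 : ℝ) ≤ K := by exact_mod_cast hK
  have h1 : Real.log (2 * (((d : ℝ) + 1) ^ K * (144 * n ^ 4 * G ^ 4) ^ K
        * ((2 * C + 1) * G ^ 2) ^ (4 * K ^ 2)))
      = Real.log 2 + (K * Real.log (d + 1) + K * (Real.log 144 + 4 * Real.log n + 4 * Real.log G)
        + 4 * K ^ 2 * (Real.log (2 * C + 1) + 2 * Real.log G)) := by
    rw [Real.log_mul (by positivity) (by positivity), Real.log_mul (by positivity) (by positivity),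
      Real.log_mul (by positivity) (by positivity), Real.log_pow, Real.log_pow, Real.log_pow,
      Real.log_mul (by positivity) (by positivity), Real.log_mul (by positivity) (by positivity),
      Real.log_mul (by positivity) (by positivity), Real.log_pow, Real.log_pow, Real.log_pow]
    push_cast
    ring
  rw [h1]
  set L := Real.log G
  have a1 : 0 ≤ Real.log 2 := Real.log_nonneg (by norm_num)
  have a2 : 0 ≤ Real.log ((d : ℝ) + 1) :=
    Real.log_nonneg (by linarith [(Nat.cast_nonneg d : (0 : ℝ) ≤ d)])
  have a3 : 0 ≤ Real.log 144 := Real.log_nonneg (by norm_num)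
  have a4 : 0 ≤ Real.log (2 * C + 1) := Real.log_nonneg (by linarith)
  have b1 : (K : ℝ) ≤ K ^ 2 := by nlinarith
  have b2 : (K : ℝ) ^ 2 ≤ K ^ 2 * L := le_mul_of_one_le_right (by positivity) hG
  have b3 : (K : ℝ) * L ≤ K ^ 2 * L := by gcongr
  have c1 := mul_le_mul_of_nonneg_left (show (1 : ℝ) ≤ K ^ 2 * L by linarith) a1
  have c2 := mul_le_mul_of_nonneg_left (b1.trans b2) a2
  have c3 := mul_le_mul_of_nonneg_left (b1.trans b2) a3
  have c4 := mul_le_mul_of_nonneg_left b2 a4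
  linarith

/-- The dominant term is `B * γ * m * B * η`, at most `C² K³ / K⁵`. A radius of order `K⁻²` is
needed since the loss multiplies it by a factor of order `B`. -/
theorem axisNet_cover_radius_le {K m : ℕ} (hm : m ≤ K) (hK : 1 ≤ K) {C γ : ℝ} (hC : 0 ≤ C)
    (hγ : 1 ≤ γ) :
    C * K * (γ * (m * (C * K * (1 / (γ * K ^ 5)) + 1 / (γ * K ^ 5)) + 1 / (γ * K ^ 5)))
      + K * (1 / (γ * K ^ 5)) + 1 / (γ * K ^ 5) ≤ (C ^ 2 + 2 * C + 2) / K ^ 2 := by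
  have hK' : (1 : ℝ) ≤ K := by exact_mod_cast hK
  have hm' : (m : ℝ) ≤ K := by exact_mod_cast hm
  have hγ0 : 0 < γ := by linarith
  have hK0 : (0 : ℝ) < K := by linarith
  have e : C * K * (γ * (m * (C * K * (1 / (γ * K ^ 5)) + 1 / (γ * K ^ 5)) + 1 / (γ * K ^ 5)))
      + K * (1 / (γ * K ^ 5)) + 1 / (γ * K ^ 5)
      = (C * K * (m * (C * K + 1) + 1) + (K + 1) / γ) / K ^ 5 := by
    field_simp
    ring
  rw [e, div_le_div_iff₀ (by positivity) (by positivity)]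
  have h1 : ((K : ℝ) + 1) / γ ≤ K + 1 := div_le_self (by positivity) hγ
  have h2 : (m : ℝ) * (C * K + 1) ≤ K * (C * K + 1) := by gcongr
  have h3 : C * K * (m * (C * K + 1) + 1) + (K + 1) / γ
      ≤ C * K * (K * (C * K + 1) + 1) + (K + 1) := by gcongr
  have hK2 : (K : ℝ) ≤ K ^ 2 := by nlinarith
  have hK3 : (K : ℝ) ^ 2 ≤ K ^ 3 := by nlinarith [sq_nonneg (K : ℝ)]
  have h4 : C * K * (K * (C * K + 1) + 1) + (K + 1) ≤ (C ^ 2 + 2 * C + 2) * K ^ 3 := by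
    nlinarith [mul_le_mul_of_nonneg_left hK3 hC, mul_le_mul_of_nonneg_left hK2 hC]
  calc _ ≤ (C ^ 2 + 2 * C + 2) * K ^ 3 * (K : ℝ) ^ 2 := by
        gcongr
        exact h3.trans h4
    _ = _ := by ring

/-- The choice `l = √r / K⁴` balances the entropy term `S / (l n)` against the variance term, of
order `l K⁴`; both become of order `√r`. -/
theorem risk_deviation_bound_le {K n S C m₁ m₂ c r : ℝ} (hK : 1 ≤ K) (hn : 0 < n)
    (hm₁ : 0 ≤ m₁) (hm₂ : 0 ≤ m₂) (hc : 0 ≤ c) (hr : r = K ^ 4 * S / n) (hr0 : 0 < r) :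
    2 * (S / (√r / K ^ 4 * n) + √r / K ^ 4 / 2 * (8 * (C * K) ^ 2 * m₂ + 2 * (C * K) ^ 4)
        + c / K ^ 2 * (2 * m₁ + 2 * (C * K)))
      ≤ 2 * (√r * (1 + 4 * C ^ 2 * m₂ + C ^ 4) + c * (2 * m₁ + 2 * C) * (1 / K)) := by
  have hK0 : 0 < K := by linarith
  have hs : 0 < √r := Real.sqrt_pos.2 hr0
  have h1 : S / (√r / K ^ 4 * n) = √r := by
    have : S / (√r / K ^ 4 * n) = (K ^ 4 * S / n) / √r := by field_simp
    rw [this, ← hr, Real.div_sqrt]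
  have h2 : √r / K ^ 4 / 2 * (8 * (C * K) ^ 2 * m₂ + 2 * (C * K) ^ 4)
      ≤ √r * (4 * C ^ 2 * m₂ + C ^ 4) := by
    have e : √r / K ^ 4 / 2 * (8 * (C * K) ^ 2 * m₂ + 2 * (C * K) ^ 4)
        = √r * (4 * C ^ 2 * m₂ / K ^ 2 + C ^ 4) := by
      field_simp
      ring
    rw [e]
    gcongr
    exact div_le_self (by positivity) (one_le_pow₀ hK)
  have h3 : c / K ^ 2 * (2 * m₁ + 2 * (C * K)) ≤ c * (2 * m₁ + 2 * C) * (1 / K) := by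
    have e : c * (2 * m₁ + 2 * C) * (1 / K) = c / K ^ 2 * ((2 * m₁ + 2 * C) * K) := by
      field_simp
    rw [e]
    gcongr
    nlinarith
  rw [h1]
  linarith

/-- `D i` are i.i.d. copies of `(X, Y)`, and `𝒟_n` is `(D 0, …, D (n-1))`. `T n` is the rule that
grows a tree from the random parameter `Θ n` and from `𝒟_n`: any rule whose trees almost surely have
`K n` leaves, with measurable shape and split directions. The expectation of the (nonnegative)
supremum is taken in `[0, ∞]`. -/
theorem proposition1 {d : ℕ}
    {Ω : Type*} [MeasurableSpace Ω] (μ : Measure Ω) [IsProbabilityMeasure μ]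
    -- the prototype pair, with `X` in the unit cube and `Y` square integrable, and the observations
    (X : Ω → Fin d → ℝ) (Y : Ω → ℝ)
    (hX : ∀ᵐ ω ∂μ, X ω ∈ Set.Icc (0 : Fin d → ℝ) 1) (hY : MemLp Y 2 μ)
    (D : ℕ → Ω → (Fin d → ℝ) × ℝ)
    (hD_indep : iIndepFun D μ)
    (hD_law : ∀ i, IdentDistrib (D i) (fun ω => (X ω, Y ω)) μ μ)
    -- the hyperparameters
    (K : ℕ → ℕ) (γ₁ γ₂ : ℕ → ℝ) (C₁ : ℝ) (hC₁ : 0 < C₁) (hγ₁ : ∀ n, 0 < γ₁ n)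
    -- the randomized, data-dependent trees
    {𝒯 : Type*} [MeasurableSpace 𝒯] (Θ : ℕ → Ω → 𝒯) (hΘ : ∀ n, Measurable (Θ n))
    (T : (n : ℕ) → 𝒯 → (Fin n → (Fin d → ℝ) × ℝ) → SplitTree (Fin d × ℝ))
    (hT_meas : ∀ n, ∀ s : SplitTree (Fin d),
      MeasurableSet {q : 𝒯 × (Fin n → (Fin d → ℝ) × ℝ) | (T n q.1 q.2).map Prod.fst = s})
    (hT_leaves : ∀ n, 2 ≤ n → ∀ᵐ ω ∂μ,
      (T n (Θ n ω) (fun i : Fin n => D i ω)).numLeaves = K n)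
    -- the asymptotic regime
    (hK : Tendsto K atTop atTop) (hγ₂ : Tendsto γ₂ atTop atTop)
    (hrate : Tendsto (fun n : ℕ => (K n : ℝ) ^ 6 * Real.log (γ₂ n * (K n : ℝ) ^ 5) / (n : ℝ))
      atTop (𝓝 0)) :
    Tendsto (fun n : ℕ => ∫⁻ ω,
        ⨆ f ∈ networkClass (γ₁ n) (γ₂ n) C₁ (T n (Θ n ω) (fun i : Fin n => D i ω)),
          ENNReal.ofReal
            |empiricalRisk (fun i : Fin n => D i ω) f - trueRisk μ X Y f| ∂μ)
      atTop (𝓝 0) := by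
  have hKr : Tendsto (fun n => (K n : ℝ)) atTop atTop := tendsto_natCast_atTop_atTop.comp hK
  set G : ℕ → ℝ := fun n => γ₂ n * (K n : ℝ) ^ 5 with hG
  have hK1 : ∀ᶠ n in atTop, 1 ≤ K n := hK.eventually_ge_atTop 1
  have hγ1 : ∀ᶠ n in atTop, 1 ≤ γ₂ n := hγ₂.eventually_ge_atTop 1
  have hKG : ∀ᶠ n in atTop, (K n : ℝ) ≤ G n := by
    filter_upwards [hK1, hγ1] with n h1 h2
    have h1' : (1 : ℝ) ≤ K n := by exact_mod_cast h1
    calc (K n : ℝ) = (K n : ℝ) ^ 1 := (pow_one _).symm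
      _ ≤ (K n : ℝ) ^ 5 := pow_le_pow_right₀ h1' (by norm_num)
      _ ≤ G n := le_mul_of_one_le_left (by positivity) h2
  have hL1 : ∀ᶠ n in atTop, 1 ≤ Real.log (G n) :=
    (Real.tendsto_log_atTop.comp (tendsto_atTop_mono' _ hKG hKr)).eventually_ge_atTop 1
  -- Eventually `log G ≥ 1`, so the rate assumption controls `K⁶ / n` itself.
  have hK6 : ∀ᶠ n : ℕ in atTop, (K n : ℝ) ^ 6 ≤ n := by
    filter_upwards [hL1, hrate.eventually (gt_mem_nhds one_pos), eventually_ge_atTop 1]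
      with n h1 h2 h3
    have hn0 : (0 : ℝ) < n := by exact_mod_cast h3
    rw [div_lt_one hn0] at h2
    exact (le_mul_of_one_le_right (by positivity) h1).trans h2.le
  set c₁ : ℝ := Real.log 2 + Real.log (d + 1) + Real.log 144 + 12
    + 4 * Real.log (2 * C₁ + 1) with hc₁
  have hc₁pos : 0 < c₁ := by
    have a1 : 0 ≤ Real.log 2 := Real.log_nonneg (by norm_num)
    have a2 : 0 ≤ Real.log ((d : ℝ) + 1) :=
      Real.log_nonneg (by linarith [(Nat.cast_nonneg d : (0 : ℝ) ≤ d)])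
    have a3 : 0 ≤ Real.log 144 := Real.log_nonneg (by norm_num)
    have a4 : 0 ≤ Real.log (2 * C₁ + 1) := Real.log_nonneg (by linarith)
    linarith
  set S : ℕ → ℝ := fun n => c₁ * ((K n : ℝ) ^ 2 * Real.log (G n)) + 4 * (K n * Real.log n) with hS
  set r : ℕ → ℝ := fun n => (K n : ℝ) ^ 4 * S n / n with hr
  have hr_lim : Tendsto r atTop (𝓝 0) := by
    have h := (hrate.const_mul c₁).add ((tendsto_pow_five_mul_log_div hK6).const_mul 4)
    simp only [mul_zero, add_zero] at h
    refine h.congr fun n => ?_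
    simp only [hr, hS, hG]
    ring
  set m₁ := ∫ ω, |Y ω| ∂μ
  set m₂ := ∫ ω, Y ω ^ 2 ∂μ with hm₂
  set c₂ := C₁ ^ 2 + 2 * C₁ + 2
  set b : ℕ → ℝ := fun n => 2 * (√(r n) * (1 + 4 * C₁ ^ 2 * m₂ + C₁ ^ 4)
    + c₂ * (2 * m₁ + 2 * C₁) * (1 / (K n : ℝ))) with hb
  have hb_lim : Tendsto b atTop (𝓝 0) := by
    have h1 : Tendsto (fun n => √(r n)) atTop (𝓝 0) := by
      have h := (Real.continuous_sqrt.tendsto 0).comp hr_lim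
      rwa [Real.sqrt_zero] at h
    have h2 : Tendsto (fun n => 1 / (K n : ℝ)) atTop (𝓝 0) :=
      tendsto_const_nhds.div_atTop hKr
    have h := ((h1.mul_const (1 + 4 * C₁ ^ 2 * m₂ + C₁ ^ 4)).add
      (h2.const_mul (c₂ * (2 * m₁ + 2 * C₁)))).const_mul 2
    simp only [zero_mul, mul_zero, add_zero] at h
    exact h
  have hlim := (tendsto_lintegral_abs_mean_sq_sub μ X Y hY D hD_indep hD_law).add
    (ENNReal.tendsto_ofReal hb_lim)
  simp only [ENNReal.ofReal_zero, add_zero] at hlim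
  refine tendsto_of_tendsto_of_tendsto_of_le_of_le' tendsto_const_nhds hlim
    (Eventually.of_forall fun n => zero_le) ?_
  filter_upwards [hK1, hγ1, hKG, hL1, eventually_ge_atTop 2] with n h1 h2 h3 h4 h5
  have hn1 : 1 ≤ n := by omega
  have hn0 : (0 : ℝ) < n := by exact_mod_cast hn1
  have hKn : (1 : ℝ) ≤ K n := by exact_mod_cast h1
  have hKn0 : (0 : ℝ) < K n := by linarith
  have hG0 : 0 < G n := by linarith
  have hr0 : 0 < r n := by
    have hlog := Real.log_natCast_nonneg n
    have : 0 < S n := by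
      have : 0 < c₁ * ((K n : ℝ) ^ 2 * Real.log (G n)) := by positivity
      have : 0 ≤ 4 * (K n * Real.log n) := by positivity
      simp only [hS]
      linarith
    simp only [hr]
    positivity
  -- Off a null set, the random class sits inside the deterministic one; `Θ` and the tree play no
  -- role afterwards.
  have hstep : ∀ᵐ ω ∂μ,
      ⨆ f ∈ networkClass (γ₁ n) (γ₂ n) C₁ (T n (Θ n ω) (fun i : Fin n => D i ω)),
        ENNReal.ofReal |empiricalRisk (fun i : Fin n => D i ω) f - trueRisk μ X Y f|
      ≤ ⨆ p ∈ boundedAxisNetParams d (K n - 1) (K n) (C₁ * K n), ENNReal.ofReal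
        |empiricalRisk (fun i : Fin n => D i ω) (axisNetEval (γ₂ n) p)
          - trueRisk μ X Y (axisNetEval (γ₂ n) p)| := by
    filter_upwards [hT_leaves n h5] with ω hω
    refine iSup₂_le fun f hf => ?_
    obtain ⟨p, hp, rfl⟩ := networkClass_subset_axisNet _ _ _ _ hω hf
    exact le_iSup₂ (f := fun p (_ : p ∈ boundedAxisNetParams d (K n - 1) (K n) (C₁ * K n)) =>
      ENNReal.ofReal |empiricalRisk (fun i : Fin n => D i ω) (axisNetEval (γ₂ n) p)
          - trueRisk μ X Y (axisNetEval (γ₂ n) p)|) p hp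
  refine (lintegral_mono_ae hstep).trans ?_
  set N : ℝ := ((d : ℝ) + 1) ^ K n * (144 * (n : ℝ) ^ 4 * G n ^ 4) ^ K n
    * ((2 * C₁ + 1) * G n ^ 2) ^ (4 * K n ^ 2) with hN
  have hN1 : 1 ≤ N := by
    have hn1' : (1 : ℝ) ≤ n := by exact_mod_cast hn1
    have hG1 : 1 ≤ G n := hKn.trans h3
    have a1 : 1 ≤ (d : ℝ) + 1 := by linarith [(Nat.cast_nonneg d : (0 : ℝ) ≤ d)]
    have a2 : 1 ≤ 144 * (n : ℝ) ^ 4 * G n ^ 4 :=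
      one_le_mul_of_one_le_of_one_le (one_le_mul_of_one_le_of_one_le (by norm_num)
        (one_le_pow₀ hn1')) (one_le_pow₀ hG1)
    have a3 : 1 ≤ (2 * C₁ + 1) * G n ^ 2 :=
      one_le_mul_of_one_le_of_one_le (by linarith) (one_le_pow₀ hG1)
    exact one_le_mul_of_one_le_of_one_le (one_le_mul_of_one_le_of_one_le (one_le_pow₀ a1)
      (one_le_pow₀ a2)) (one_le_pow₀ a3)
  have hl : 0 < √(r n) / (K n : ℝ) ^ 4 := div_pos (Real.sqrt_pos.2 hr0) (by positivity)
  refine (lintegral_iSup_axisNet_deviation_le (η := 1 / G n) hn1 μ X Y hY D hD_indep hD_law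
    (by linarith) (by positivity) (by positivity) hl hN1
    (axisNetCodeCard_le (Nat.sub_le _ _) h1 hn1 hC₁.le h3)
    (axisNet_cover_radius_le (Nat.sub_le _ _) h1 hC₁.le h2)).trans ?_
  gcongr
  refine le_trans ?_ (risk_deviation_bound_le hKn hn0
    (integral_nonneg fun ω => abs_nonneg _) (integral_nonneg fun ω => sq_nonneg _)
    (by positivity) rfl hr0)
  gcongr
  exact log_axisNet_cover_le h1 hn1 hC₁.le h4 hG0
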